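/- Let $\mathcal P(\mathbb R^d)$ be the set of Borel probability measures on $\mathbb R^d$ with the topology of weak convergence. A *flat derivative* of $G:\mathcal P(\mathbb R^d)\to\mathbb R$ is a function $\frac{\delta G}{\delta m}:\mathcal P(\mathbb R^d)\times\mathbb R^d\to\mathbb R$, measurable and bounded in $x$ for each $m$ and continuous in $m$ for each $x$, such that for all $m,m'$ $$G(m')-G(m)=\int_0^1\int_{\mathbb R^d}\frac{\delta G}{\delta m}\big(m+\lambda(m'-m),x\big)\,(m'-m)(dx)\,d\lambda .$$ Let $F:\mathcal P(\mathbb R^d)\to\mathbb R$ have a flat derivative $\frac{\delta F}{\delta m}$, normalised by $\int\frac{\delta F}{\delta m}(m,x)\,m(dx)=0$ for all $m$, and a second flat derivative $\frac{\delta^2F}{\delta m^2}$ (that is, for every $x$, $(m,y)\mapsto\frac{\delta^2F}{\delta m^2}(m,x,y)$ is a flat derivative of $m\mapsto\frac{\delta F}{\delta m}(m,x)$). Suppose that 1. $F(m)-F(m')\le\int\frac{\delta F}{\delta m}(m,x)\,(m-m')(dx)$ for all $m,m'\in\mathcal P(\mathbb R^d)$; 2. there is $C>0$ with $\big|\frac{\delta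 F}{\delta m}(m,x)\big|\le C$ for all $m,x$; 3. there is $C_2>0$ with $\big|\frac{\delta^2F}{\delta m^2}(m,x,y)\big|\le C_2$ for all $m,x,y$. Let $\sigma\ge0$, let $\pi$ be a probability measure with density $\pi(x)\propto e^{-U(x)}$ for some $U:\mathbb R^d\to\mathbb R$, and let $m_0$ be a probability measure with a density such that $m_0(x)/\pi(x)\le R$ for (almost) all $x$, for some constant $R>1$. Put $$V^\sigma(m)=F(m)+\frac{\sigma^2}{2}\operatorname{KL}(m|\pi),\qquad a(m,x)=\frac{\delta F}{\delta m}(m,x)+\frac{\sigma^2}{2}\log\frac{m(x)}{\pi(x)}-\frac{\sigma^2}{2}\operatorname{KL}(m|\pi),$$ and consider the birth-death equation $$\partial_t m_t(x)=-a(m_t,x)\,m_t(x),\qquad t\ge0,$$ with initial value $m_0$. A solution is a family $(m_t)_{t\ge0}$ of probability measures with densities $m_t(x)$ and $\operatorname{KL}(m_t|\pi)<\infty$, starting at $m_0$, such that for almost every $x$ the equation holds for all $t\ge0$ (one-sided derivative at $t=0$; the right-hand side is read as $0$ where $m_t(x)=0$). Then there is a unique solution $(m_t)_{t\ge0}$,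 the function $t\mapsto V^\sigma(m_t)$ is differentiable on $[0,\infty)$ (from the right at $t=0$), and for every $t\ge0$ $$\partial_tV^\sigma(m_t)=-\int_{\mathbb R^d}|a(m_t,x)|^2\,m_t(x)\,dx ,$$ where the integral on the right is finite. -/

import Mathlib

open MeasureTheory

noncomputable section

/-- The mixture `m + l (m' - m) = (1 - l) m + l m'` of two probability measures, `l ∈ [0, 1]`. -/
def mixture {E : Type*} [MeasurableSpace E] (m m' : ProbabilityMeasure E) (l : unitInterval) :
    ProbabilityMeasure E :=
  ⟨ENNReal.ofReal (1 - (l : ℝ)) • (m : Measure E) + ENNReal.ofReal (l : ℝ) • (m' : Measure E), by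
    constructor
    simp only [Measure.coe_add, Measure.coe_smul, Pi.add_apply, Pi.smul_apply, measure_univ,
      smul_eq_mul, mul_one]
    rw [← ENNReal.ofReal_add (sub_nonneg.2 l.2.2) l.2.1]
    simp⟩

/-- `dF` is a flat (linear functional) derivative of `F` on the space of all Borel probability
measures, which carries the topology of weak convergence. -/
structure IsFlatDerivative {d : ℕ} (F : ProbabilityMeasure (EuclideanSpace ℝ (Fin d)) → ℝ)
    (dF : ProbabilityMeasure (EuclideanSpace ℝ (Fin d)) → EuclideanSpace ℝ (Fin d) → ℝ) :
    Prop where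
  continuous : ∀ x, Continuous fun m => dF m x
  measurable : ∀ m, Measurable (dF m)
  bounded : ∀ m, ∃ C > 0, ∀ x, |dF m x| ≤ C
  integrable : ∀ m m' : ProbabilityMeasure (EuclideanSpace ℝ (Fin d)), Integrable fun l : unitInterval =>
    (∫ x, dF (mixture m m' l) x ∂(m' : Measure (EuclideanSpace ℝ (Fin d)))) -
      ∫ x, dF (mixture m m' l) x ∂(m : Measure (EuclideanSpace ℝ (Fin d)))
  sub_eq : ∀ m m' : ProbabilityMeasure (EuclideanSpace ℝ (Fin d)), F m' - F m = ∫ l : unitInterval,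
    ((∫ x, dF (mixture m m' l) x ∂(m' : Measure (EuclideanSpace ℝ (Fin d)))) -
      ∫ x, dF (mixture m m' l) x ∂(m : Measure (EuclideanSpace ℝ (Fin d))))

/-- The assumption on `F`: it has a normalised first flat derivative `dF` and a second flat
derivative `d2F` (the flat derivative of `m ↦ dF m x` for every `x`), it is convex, and both
derivatives are uniformly bounded. -/
structure EnergyAssumption {d : ℕ} (F : ProbabilityMeasure (EuclideanSpace ℝ (Fin d)) → ℝ)
    (dF : ProbabilityMeasure (EuclideanSpace ℝ (Fin d)) → EuclideanSpace ℝ (Fin d) → ℝ)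
    (d2F : ProbabilityMeasure (EuclideanSpace ℝ (Fin d)) →
      EuclideanSpace ℝ (Fin d) → EuclideanSpace ℝ (Fin d) → ℝ) : Prop where
  first : IsFlatDerivative F dF
  normalised : ∀ m : ProbabilityMeasure (EuclideanSpace ℝ (Fin d)),
    ∫ x, dF m x ∂(m : Measure (EuclideanSpace ℝ (Fin d))) = 0
  second : ∀ x, IsFlatDerivative (fun m => dF m x) (fun m y => d2F m x y)
  convex : ∀ m m' : ProbabilityMeasure (EuclideanSpace ℝ (Fin d)), F m - F m' ≤
    (∫ x, dF m x ∂(m : Measure (EuclideanSpace ℝ (Fin d)))) -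
      ∫ x, dF m x ∂(m' : Measure (EuclideanSpace ℝ (Fin d)))
  bound_first : ∃ C > 0, ∀ m x, |dF m x| ≤ C
  bound_second : ∃ C₂ > 0, ∀ m x y, |d2F m x y| ≤ C₂

/-- `ρ` is a (Borel, nonnegative) density of `m` with respect to Lebesgue measure. -/
structure HasDensity {d : ℕ} (m : ProbabilityMeasure (EuclideanSpace ℝ (Fin d)))
    (ρ : EuclideanSpace ℝ (Fin d) → ℝ) : Prop where
  measurable : Measurable ρ
  nonneg : ∀ x, 0 ≤ ρ x
  eq_withDensity : (m : Measure (EuclideanSpace ℝ (Fin d))) =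
    volume.withDensity fun x => ENNReal.ofReal (ρ x)

/-- The function proportional to `exp (-U)` of total integral one. -/
def gibbsDensity {d : ℕ} (U : EuclideanSpace ℝ (Fin d) → ℝ) (x : EuclideanSpace ℝ (Fin d)) : ℝ :=
  Real.exp (-U x) / ∫ y, Real.exp (-U y)

/-- `KL(m | π)` as a real number; used only where `InformationTheory.klDiv m π` is finite. -/
def klReal {d : ℕ} (m π : ProbabilityMeasure (EuclideanSpace ℝ (Fin d))) : ℝ :=
  (InformationTheory.klDiv (m : Measure (EuclideanSpace ℝ (Fin d)))
    (π : Measure (EuclideanSpace ℝ (Fin d)))).toReal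

/-- The energy `V^σ(m) = F(m) + (σ² / 2) KL(m | π)`; used only where `KL(m | π)` is finite. -/
def energy {d : ℕ} (F : ProbabilityMeasure (EuclideanSpace ℝ (Fin d)) → ℝ) (σ : ℝ)
    (π m : ProbabilityMeasure (EuclideanSpace ℝ (Fin d))) : ℝ :=
  F m + σ ^ 2 / 2 * klReal m π

/-- The rate `a(m, x) = dF(m, x) + (σ² / 2) log (m(x) / π(x)) - (σ² / 2) KL(m | π)`, where `ρ` is
the density of `m` and `π` is the probability measure with density proportional to `exp (-U)`.
It is only ever multiplied by `ρ x`, so its value where `ρ x = 0` is irrelevant. -/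
def birthDeathRate {d : ℕ}
    (dF : ProbabilityMeasure (EuclideanSpace ℝ (Fin d)) → EuclideanSpace ℝ (Fin d) → ℝ) (σ : ℝ)
    (U : EuclideanSpace ℝ (Fin d) → ℝ) (π m : ProbabilityMeasure (EuclideanSpace ℝ (Fin d)))
    (ρ : EuclideanSpace ℝ (Fin d) → ℝ) (x : EuclideanSpace ℝ (Fin d)) : ℝ :=
  dF m x + σ ^ 2 / 2 * Real.log (ρ x / gibbsDensity U x) - σ ^ 2 / 2 * klReal m π

/-- `(m t)`, `t ≥ 0`, with densities `ρ t`, solves `∂ₜ m_t(x) = - a(m_t, x) m_t(x)` with initial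
value `m₀`: all `KL(m_t | π)` are finite, and for almost every `x` the equation holds at all times
`t ≥ 0` (with the right derivative at `t = 0`). Values at negative times play no role. -/
structure IsBirthDeathSolution {d : ℕ}
    (dF : ProbabilityMeasure (EuclideanSpace ℝ (Fin d)) → EuclideanSpace ℝ (Fin d) → ℝ) (σ : ℝ)
    (U : EuclideanSpace ℝ (Fin d) → ℝ) (π m₀ : ProbabilityMeasure (EuclideanSpace ℝ (Fin d)))
    (m : ℝ → ProbabilityMeasure (EuclideanSpace ℝ (Fin d)))
    (ρ : ℝ → EuclideanSpace ℝ (Fin d) → ℝ) : Prop where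
  initial : m 0 = m₀
  density : ∀ t, 0 ≤ t → HasDensity (m t) (ρ t)
  kl_ne_top : ∀ t, 0 ≤ t → InformationTheory.klDiv (m t : Measure (EuclideanSpace ℝ (Fin d)))
    (π : Measure (EuclideanSpace ℝ (Fin d))) ≠ ⊤
  equation : ∀ᵐ x, ∀ t, 0 ≤ t → HasDerivWithinAt (fun s => ρ s x)
    (-(birthDeathRate dF σ U π (m t) (ρ t) x) * ρ t x) (Set.Ici 0) t

end

/-! Write `s = σ² / 2` and let `f_t` be the density of `m_t` with respect to `π`. Up to a term that
depends on time only, `log f_t` solves the linear equation `∂ₜ log f = -(dF(m_t) + s log f)`. The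
integrating factor `exp (s t)` gives `f_t ∝ (g exp (-k_t)) ^ exp (-s t)`, where `g` is a version of
the initial density bounded by `R`, `k_0 = 0` and `k' = exp (s t) dF(m_t)`. Since `m_t` is
determined by `t` and `k_t`, the equation becomes an ordinary differential equation for `k` in the
Banach space of bounded measurable functions.

Its vector field is globally Lipschitz. The bounded second flat derivative makes `dF` Lipschitz in
total variation, and perturbing `k` moves the normalised power by at most `4 exp (-s t) ‖k - k'‖` in
`L¹`; the factor `exp (s t)` cancels (`exists_lipschitzWith`). Picard–Lindelöf then gives a global
`k` (`exists_flow`). Normalising the weight produces exactly the term `s KL`, because `dF` has mean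
zero (`isReplicatorFlow`).

For uniqueness, the scalar equation at each point is solved explicitly, so that any solution has the
same form with some `k'` (`exists_eq_powDensity`), and `k'` solves the same Lipschitz equation as
`k`.

For dissipation, `f_t` is bounded locally uniformly in time, hence so are `f log f` and `f log² f`,
and one may differentiate under the integral. `F(m_t)` is handled by a first-order expansion whose
remainder is quadratic in total variation (`hasDerivAt_functional`). Adding the entropy derivative
gives `-∫ a² f`, because `a` has mean zero (`hasDerivAt_energy`). -/

open MeasureTheory

open scoped ENNReal NNReal Topology

/-! ### Global solutions of Lipschitz differential equations -/

section GlobalODE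

variable {E : Type*} [NormedAddCommGroup E] [NormedSpace ℝ E]

/-- A globally Lipschitz vector field, continuous in time and bounded on bounded time intervals,
has a global integral curve through every point. -/
theorem exists_forall_hasDerivAt_of_lipschitzWith [CompleteSpace E] {v : ℝ → E → E} {K : ℝ≥0}
    (hv : ∀ t, LipschitzWith K (v t)) (hc : ∀ x, Continuous fun t => v t x)
    (hb : ∀ T : ℝ, ∃ L : ℝ≥0, ∀ t ∈ Set.Icc (-T) T, ∀ x, ‖v t x‖ ≤ L) (x₀ : E) :
    ∃ α : ℝ → E, α 0 = x₀ ∧ ∀ t, HasDerivAt α (v t (α t)) t := by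
  -- The field is bounded by `L` on the whole space, so a ball of radius `L * (n + 1)` contains the
  -- motion up to time `n + 1`; no smallness of the interval is needed.
  have hloc : ∀ n : ℕ, ∃ α : ℝ → E, α 0 = x₀ ∧
      ∀ t ∈ Set.Icc (-(n + 1 : ℝ)) (n + 1),
        HasDerivWithinAt α (v t (α t)) (Set.Icc (-(n + 1 : ℝ)) (n + 1)) t := by
    intro n
    obtain ⟨L, hL⟩ := hb (n + 1)
    have h0 : (0 : ℝ) ∈ Set.Icc (-(n + 1 : ℝ)) (n + 1) := by
      constructor <;> linarith [(Nat.cast_nonneg n : (0 : ℝ) ≤ n)]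
    have hP : IsPicardLindelof v (tmin := -(n + 1 : ℝ)) (tmax := n + 1) ⟨0, h0⟩ x₀
        (L * (n + 1)) 0 L K := by
      refine ⟨fun t _ => (hv t).lipschitzOnWith, fun x _ => (hc x).continuousOn,
        fun t ht x _ => hL t ht x, ?_⟩
      simp
    exact hP.exists_eq_forall_mem_Icc_hasDerivWithinAt₀
  choose α hα0 hα using hloc
  have hder : ∀ n : ℕ, ∀ t ∈ Set.Ioo (-(n + 1 : ℝ)) (n + 1),
      HasDerivAt (α n) (v t (α n t)) t := fun n t ht =>
    (hα n t (Set.Ioo_subset_Icc_self ht)).hasDerivAt (Icc_mem_nhds ht.1 ht.2)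
  have huniq : ∀ m n : ℕ, m ≤ n → ∀ t ∈ Set.Ioo (-(m + 1 : ℝ)) (m + 1), α m t = α n t := by
    intro m n hmn
    have hmn' : (m : ℝ) ≤ n := by exact_mod_cast hmn
    have hm : (0 : ℝ) ≤ m := m.cast_nonneg
    refine ODE_solution_unique_of_mem_Ioo (v := v) (s := fun _ => Set.univ) (K := K)
      (t₀ := 0) (fun t _ => (hv t).lipschitzOnWith) (by constructor <;> linarith)
      (fun t ht => ⟨hder m t ht, trivial⟩)
      (fun t ht => ⟨hder n t ⟨by linarith [ht.1], by linarith [ht.2]⟩, trivial⟩) ?_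
    rw [hα0, hα0]
  -- The local solutions are glued by using at time `t` the one with index `⌊|t|⌋₊`, whose open
  -- interval contains `t` since `|t| < ⌊|t|⌋₊ + 1`.
  have hagree : ∀ n : ℕ, ∀ t : ℝ, |t| < n + 1 → α ⌊|t|⌋₊ t = α n t := by
    intro n t ht
    have hmem : t ∈ Set.Ioo (-((⌊|t|⌋₊ : ℕ) + 1 : ℝ)) ((⌊|t|⌋₊ : ℕ) + 1) :=
      abs_lt.1 (Nat.lt_floor_add_one _)
    refine huniq _ _ ?_ t hmem
    have : (⌊|t|⌋₊ : ℕ) < n + 1 := by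
      rw [Nat.floor_lt (abs_nonneg _)]
      exact_mod_cast ht
    omega
  refine ⟨fun t => α ⌊|t|⌋₊ t, by simp [hα0], fun t => ?_⟩
  have ht : |t| < (⌊|t|⌋₊ : ℕ) + 1 := Nat.lt_floor_add_one _
  refine (hder _ t (abs_lt.1 ht)).congr_of_eventuallyEq ?_
  filter_upwards [continuous_abs.continuousAt.eventually (gt_mem_nhds ht)] with s hs
  exact hagree _ s hs

theorem eq_of_forall_hasDerivAt_of_lipschitzWith {v : ℝ → E → E} {K : ℝ≥0}
    (hv : ∀ t, LipschitzWith K (v t)) {f g : ℝ → E}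
    (hf : ∀ t, 0 ≤ t → HasDerivAt f (v t (f t)) t)
    (hg : ∀ t, 0 ≤ t → HasDerivAt g (v t (g t)) t) (h0 : f 0 = g 0) {t : ℝ} (ht : 0 ≤ t) :
    f t = g t :=
  ODE_solution_unique (a := 0) (b := t) hv
    (fun s hs => (hf s hs.1).continuousAt.continuousWithinAt)
    (fun s hs => (hf s hs.1).hasDerivWithinAt)
    (fun s hs => (hg s hs.1).continuousAt.continuousWithinAt)
    (fun s hs => (hg s hs.1).hasDerivWithinAt) h0 ⟨ht, le_rfl⟩

end GlobalODE

/-! ### The Banach space of bounded measurable functions -/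

section BoundedMeasurable

variable (Ω : Type*) [MeasurableSpace Ω]

/-- The bounded measurable real functions, with the supremum norm. -/
def boundedMeasurable : Submodule ℝ (lp (fun _ : Ω => ℝ) ∞) where
  carrier := {f | Measurable fun x => f x}
  add_mem' hf hg := by
    simp only [Set.mem_ofPred_eq, lp.coeFn_add, Pi.add_apply] at *
    exact hf.add hg
  zero_mem' := by
    simp only [Set.mem_ofPred_eq, lp.coeFn_zero, Pi.zero_apply]
    exact measurable_const
  smul_mem' c f hf := by
    simp only [Set.mem_ofPred_eq, lp.coeFn_smul, Pi.smul_apply] at *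
    exact hf.const_smul c

variable {Ω}

/-- Uniform limits are pointwise limits, and these preserve measurability. The sup norm over all
points, with no null sets removed, is what makes evaluation at a point continuous. -/
theorem isClosed_boundedMeasurable :
    IsClosed (boundedMeasurable Ω : Set (lp (fun _ : Ω => ℝ) ∞)) := by
  refine isClosed_of_closure_subset fun f hf => ?_
  obtain ⟨u, hu, hlim⟩ := mem_closure_iff_seq_limit.1 hf
  refine measurable_of_tendsto_metrizable (f := fun n x => u n x) hu ?_
  rw [tendsto_pi_nhds]
  intro x
  rw [tendsto_iff_norm_sub_tendsto_zero] at hlim ⊢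
  refine squeeze_zero (fun _ => norm_nonneg _) (fun n => ?_) hlim
  exact lp.norm_apply_le_norm ENNReal.top_ne_zero (u n - f) x

instance : CompleteSpace (boundedMeasurable Ω) :=
  isClosed_boundedMeasurable.completeSpace_coe

namespace boundedMeasurable

instance : CoeFun (boundedMeasurable Ω) fun _ => Ω → ℝ := ⟨fun f => (f : lp (fun _ : Ω => ℝ) ∞)⟩

theorem measurable (f : boundedMeasurable Ω) : Measurable f := f.2

theorem abs_apply_le (f : boundedMeasurable Ω) (x : Ω) : |f x| ≤ ‖f‖ :=
  lp.norm_apply_le_norm ENNReal.top_ne_zero (f : lp (fun _ : Ω => ℝ) ∞) x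

theorem abs_sub_apply_le (f g : boundedMeasurable Ω) (x : Ω) : |f x - g x| ≤ ‖f - g‖ :=
  abs_apply_le (f - g) x

theorem norm_le {f : boundedMeasurable Ω} {C : ℝ} (hC : 0 ≤ C) (h : ∀ x, |f x| ≤ C) : ‖f‖ ≤ C :=
  lp.norm_le_of_forall_le hC h

@[simp] theorem smul_apply (c : ℝ) (f : boundedMeasurable Ω) (x : Ω) : (c • f) x = c * f x := rfl

@[simp] theorem zero_apply (x : Ω) : (0 : boundedMeasurable Ω) x = 0 := rfl

/-- A bounded measurable function as an element of `boundedMeasurable`. -/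
def mk (f : Ω → ℝ) (hf : Measurable f) (hb : ∃ C, ∀ x, |f x| ≤ C) : boundedMeasurable Ω :=
  ⟨⟨f, memℓp_infty (by obtain ⟨C, hC⟩ := hb; exact ⟨C, by rintro _ ⟨x, rfl⟩; exact hC x⟩)⟩, hf⟩

/-- Evaluation at a point. -/
noncomputable def eval (x : Ω) : boundedMeasurable Ω →L[ℝ] ℝ :=
  LinearMap.mkContinuous
    { toFun := fun f => f x
      map_add' := fun _ _ => rfl
      map_smul' := fun _ _ => rfl } 1 fun f => (abs_apply_le f x).trans (one_mul _).ge

theorem hasDerivAt_apply {f : ℝ → boundedMeasurable Ω} {f' : boundedMeasurable Ω} {t : ℝ}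
    (h : HasDerivAt f f' t) (x : Ω) : HasDerivAt (fun s => f s x) (f' x) t :=
  (eval x).hasFDerivAt.comp_hasDerivAt t h

end boundedMeasurable

end BoundedMeasurable

/-! ### Probability densities with respect to a reference measure -/

section Density

variable {Ω : Type*} [MeasurableSpace Ω]

/-- `f` is a nonnegative density of the probability measure `m` with respect to `μ`. -/
structure IsDensity (μ : Measure Ω) (m : ProbabilityMeasure Ω) (f : Ω → ℝ) : Prop where
  measurable : Measurable f
  nonneg : ∀ x, 0 ≤ f x
  eq_withDensity : (m : Measure Ω) = μ.withDensity fun x => ENNReal.ofReal (f x)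

variable {μ : Measure Ω} {m m' : ProbabilityMeasure Ω} {f f' : Ω → ℝ}

theorem integrable_withDensity_ofReal_iff (hf : Measurable f) (h0 : ∀ x, 0 ≤ f x) {φ : Ω → ℝ} :
    Integrable φ (μ.withDensity fun x => ENNReal.ofReal (f x)) ↔
      Integrable (fun x => f x * φ x) μ := by
  rw [integrable_withDensity_iff_integrable_smul' hf.ennreal_ofReal (by simp)]
  simp [ENNReal.toReal_ofReal (h0 _)]

theorem integral_withDensity_ofReal (hf : Measurable f) (h0 : ∀ x, 0 ≤ f x) (φ : Ω → ℝ) :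
    ∫ x, φ x ∂(μ.withDensity fun x => ENNReal.ofReal (f x)) = ∫ x, f x * φ x ∂μ := by
  rw [integral_withDensity_eq_integral_toReal_smul hf.ennreal_ofReal (by simp)]
  simp [ENNReal.toReal_ofReal (h0 _)]

namespace IsDensity

theorem integrable_iff (h : IsDensity μ m f) {φ : Ω → ℝ} :
    Integrable φ (m : Measure Ω) ↔ Integrable (fun x => f x * φ x) μ := by
  rw [h.eq_withDensity, integrable_withDensity_ofReal_iff h.measurable h.nonneg]

theorem integral_eq (h : IsDensity μ m f) (φ : Ω → ℝ) :
    ∫ x, φ x ∂(m : Measure Ω) = ∫ x, f x * φ x ∂μ := by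
  rw [h.eq_withDensity, integral_withDensity_ofReal h.measurable h.nonneg]

theorem integrable (h : IsDensity μ m f) : Integrable f μ := by
  have := (h.integrable_iff (φ := fun _ => 1)).1 (integrable_const _)
  simpa using this

theorem integral_eq_one (h : IsDensity μ m f) : ∫ x, f x ∂μ = 1 := by
  have := h.integral_eq fun _ => 1
  simpa using this.symm

theorem integrable_mul (h : IsDensity μ m f) {φ : Ω → ℝ} (hφ : Measurable φ) {C : ℝ}
    (hC : ∀ x, |φ x| ≤ C) : Integrable (fun x => f x * φ x) μ :=
  h.integrable.mul_bdd hφ.aestronglyMeasurable (.of_forall hC)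

theorem isProbabilityMeasure_withDensity (h0 : ∀ x, 0 ≤ f x)
    (h1 : ∫ x, f x ∂μ = 1) :
    IsProbabilityMeasure (μ.withDensity fun x => ENNReal.ofReal (f x)) := by
  -- The integral of a non-integrable function is `0` by convention, so the value `1` forces
  -- integrability.
  have hint : Integrable f μ := by
    by_contra h
    simp [integral_undef h] at h1
  constructor
  rw [withDensity_apply _ .univ, Measure.restrict_univ,
    ← ofReal_integral_eq_lintegral_ofReal hint (.of_forall h0), h1, ENNReal.ofReal_one]

theorem congr_ae (h : IsDensity μ m f) (hf' : Measurable f') (h0 : ∀ x, 0 ≤ f' x)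
    (hff' : f =ᵐ[μ] f') : IsDensity μ m f' where
  measurable := hf'
  nonneg := h0
  eq_withDensity := by
    rw [h.eq_withDensity]
    exact withDensity_congr_ae (hff'.mono fun x hx => by simp only [hx])

theorem eq_of_ae_eq (h : IsDensity μ m f) (h' : IsDensity μ m' f') (hff' : f =ᵐ[μ] f') :
    m = m' := by
  apply Subtype.ext
  change (m : Measure Ω) = m'
  rw [h.eq_withDensity, h'.eq_withDensity]
  exact withDensity_congr_ae (hff'.mono fun x hx => by simp only [hx])

/-- The density of a mixture. -/
theorem mixture (h : IsDensity μ m f) (h' : IsDensity μ m' f') (l : unitInterval) :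
    IsDensity μ (mixture m m' l) fun x => (1 - (l : ℝ)) * f x + l * f' x where
  measurable := (h.measurable.const_mul _).add (h'.measurable.const_mul _)
  nonneg x := add_nonneg (mul_nonneg (sub_nonneg.2 l.2.2) (h.nonneg x))
    (mul_nonneg l.2.1 (h'.nonneg x))
  eq_withDensity := by
    change ENNReal.ofReal (1 - (l : ℝ)) • (m : Measure Ω) +
      ENNReal.ofReal (l : ℝ) • (m' : Measure Ω) = _
    rw [h.eq_withDensity, h'.eq_withDensity,
      ← withDensity_smul _ h.measurable.ennreal_ofReal,
      ← withDensity_smul _ h'.measurable.ennreal_ofReal,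
      ← withDensity_add_left (h.measurable.ennreal_ofReal.const_smul _)]
    congr 1
    funext x
    simp only [Pi.add_apply, Pi.smul_apply, smul_eq_mul]
    rw [ENNReal.ofReal_add (mul_nonneg (sub_nonneg.2 l.2.2) (h.nonneg x))
      (mul_nonneg l.2.1 (h'.nonneg x)), ENNReal.ofReal_mul (sub_nonneg.2 l.2.2),
      ENNReal.ofReal_mul l.2.1]

theorem integral_abs_mixture_sub (h : IsDensity μ m f) (h' : IsDensity μ m' f')
    (l : unitInterval) :
    ∫ x, |(1 - (l : ℝ)) * f x + l * f' x - f x| ∂μ ≤ ∫ x, |f' x - f x| ∂μ := by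
  refine integral_mono ((h.mixture h' l).integrable.sub h.integrable).abs
    (h'.integrable.sub h.integrable).abs fun x => ?_
  have : (1 - (l : ℝ)) * f x + l * f' x - f x = l * (f' x - f x) := by ring
  simp only [this, abs_mul, abs_of_nonneg l.2.1]
  exact mul_le_of_le_one_left (abs_nonneg _) l.2.2

theorem abs_integral_sub_integral_sub_le (h : IsDensity μ m f) (h' : IsDensity μ m' f')
    {φ ψ : Ω → ℝ} (hφ : Measurable φ) (hψ : Measurable ψ) {A C : ℝ} (hA : ∀ x, |φ x| ≤ A)
    (hC : ∀ x, |φ x - ψ x| ≤ C) :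
    |(∫ x, φ x ∂(m' : Measure Ω)) - ∫ x, φ x ∂(m : Measure Ω) -
      ∫ x, ψ x * (f' x - f x) ∂μ| ≤ C * ∫ x, |f' x - f x| ∂μ := by
  have hA' : ∀ x, |ψ x| ≤ A + C := fun x => by
    have h1 := hA x
    have h2 := hC x
    rw [abs_le] at *
    constructor <;> linarith
  have hdiff := h'.integrable.sub h.integrable
  have hψi : Integrable (fun x => ψ x * (f' x - f x)) μ :=
    hdiff.bdd_mul hψ.aestronglyMeasurable (.of_forall hA')
  have hφi : Integrable (fun x => f' x * φ x - f x * φ x) μ :=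
    (h'.integrable_mul hφ hA).sub (h.integrable_mul hφ hA)
  rw [h'.integral_eq, h.integral_eq, ← integral_sub (h'.integrable_mul hφ hA)
    (h.integrable_mul hφ hA), ← integral_sub hφi hψi, ← integral_const_mul]
  refine (abs_integral_le_integral_abs).trans ?_
  refine integral_mono (hφi.sub hψi).abs
    (hdiff.abs.const_mul _) fun x => ?_
  have : f' x * φ x - f x * φ x - ψ x * (f' x - f x) = (φ x - ψ x) * (f' x - f x) := by ring
  simp only [this, abs_mul]
  exact mul_le_mul_of_nonneg_right (hC x) (abs_nonneg _)

end IsDensity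

theorem exists_isDensity (hf : Measurable f) (h0 : ∀ x, 0 ≤ f x) (h1 : ∫ x, f x ∂μ = 1) :
    ∃ m : ProbabilityMeasure Ω, IsDensity μ m f :=
  ⟨⟨_, IsDensity.isProbabilityMeasure_withDensity h0 h1⟩, hf, h0, rfl⟩

end Density

/-! ### Flat derivatives and densities -/

section Flat

variable {d : ℕ} {μ : Measure (EuclideanSpace ℝ (Fin d))}
  {m m' : ProbabilityMeasure (EuclideanSpace ℝ (Fin d))}
  {f f' : EuclideanSpace ℝ (Fin d) → ℝ}
  {G : ProbabilityMeasure (EuclideanSpace ℝ (Fin d)) → ℝ}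
  {dG : ProbabilityMeasure (EuclideanSpace ℝ (Fin d)) → EuclideanSpace ℝ (Fin d) → ℝ}

/-- A first-order expansion of a function with a flat derivative. -/
theorem IsFlatDerivative.abs_sub_sub_integral_le (hG : IsFlatDerivative G dG)
    (h : IsDensity μ m f) (h' : IsDensity μ m' f') {ψ : EuclideanSpace ℝ (Fin d) → ℝ}
    (hψ : Measurable ψ) {C : ℝ} (hC : ∀ l x, |dG (mixture m m' l) x - ψ x| ≤ C) :
    |G m' - G m - ∫ x, ψ x * (f' x - f x) ∂μ| ≤ C * ∫ x, |f' x - f x| ∂μ := by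
  rw [hG.sub_eq m m']
  have hc : ∫ x, ψ x * (f' x - f x) ∂μ =
      ∫ _ : unitInterval, ∫ x, ψ x * (f' x - f x) ∂μ := by simp
  rw [hc, ← integral_sub (hG.integrable m m') (integrable_const _), ← Real.norm_eq_abs]
  refine le_of_le_of_eq (norm_integral_le_of_norm_le_const (μ := (volume : Measure unitInterval))
    (C := C * ∫ x, |f' x - f x| ∂μ) (.of_forall fun l => ?_)) (by simp)
  obtain ⟨A, -, hA⟩ := hG.bounded (mixture m m' l)
  exact h.abs_integral_sub_integral_sub_le h' (hG.measurable _) hψ hA (hC l)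

/-- A function with a bounded flat derivative is Lipschitz in total variation. -/
theorem IsFlatDerivative.abs_sub_le (hG : IsFlatDerivative G dG)
    (h : IsDensity μ m f) (h' : IsDensity μ m' f') {C : ℝ} (hC : ∀ m x, |dG m x| ≤ C) :
    |G m' - G m| ≤ C * ∫ x, |f' x - f x| ∂μ := by
  have := hG.abs_sub_sub_integral_le h h' (ψ := 0) measurable_const (C := C)
    (fun l x => by simpa using hC (mixture m m' l) x)
  simpa using this

end Flat

/-! ### Relative entropy of a density -/

section Entropy

variable {d : ℕ} {π m : ProbabilityMeasure (EuclideanSpace ℝ (Fin d))}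
  {f : EuclideanSpace ℝ (Fin d) → ℝ}

theorem IsDensity.llr_ae_eq (h : IsDensity (π : Measure (EuclideanSpace ℝ (Fin d))) m f) :
    llr (m : Measure (EuclideanSpace ℝ (Fin d))) π
      =ᵐ[(m : Measure (EuclideanSpace ℝ (Fin d)))] fun x => Real.log (f x) := by
  have hac : (m : Measure (EuclideanSpace ℝ (Fin d))) ≪ π := by
    rw [h.eq_withDensity]
    exact withDensity_absolutelyContinuous _ _
  refine hac.ae_le ?_
  have := Measure.rnDeriv_withDensity (π : Measure (EuclideanSpace ℝ (Fin d)))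
    h.measurable.ennreal_ofReal
  rw [← h.eq_withDensity] at this
  filter_upwards [this] with x hx
  rw [llr, hx, ENNReal.toReal_ofReal (h.nonneg x)]

theorem IsDensity.klDiv_ne_top (h : IsDensity (π : Measure (EuclideanSpace ℝ (Fin d))) m f)
    (hi : Integrable (fun x => f x * Real.log (f x)) (π : Measure (EuclideanSpace ℝ (Fin d)))) :
    InformationTheory.klDiv (m : Measure (EuclideanSpace ℝ (Fin d)))
      (π : Measure (EuclideanSpace ℝ (Fin d))) ≠ ⊤ := by
  refine InformationTheory.klDiv_ne_top ?_ ?_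
  · rw [h.eq_withDensity]
    exact withDensity_absolutelyContinuous _ _
  · exact (integrable_congr h.llr_ae_eq).2 (h.integrable_iff.2 hi)

theorem IsDensity.klReal_eq (h : IsDensity (π : Measure (EuclideanSpace ℝ (Fin d))) m f) :
    klReal m π = ∫ x, f x * Real.log (f x) ∂(π : Measure (EuclideanSpace ℝ (Fin d))) := by
  rw [klReal, InformationTheory.toReal_klDiv_of_measure_eq _ (by simp),
    integral_congr_ae h.llr_ae_eq, h.integral_eq]
  rw [h.eq_withDensity]
  exact withDensity_absolutelyContinuous _ _

end Entropy

/-! ### Convergence and comparison of densities in total variation -/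

section TotalVariation

variable {Ω : Type*} [MeasurableSpace Ω] {μ : Measure Ω}

/-- **Scheffé's lemma**: densities that converge almost everywhere converge in `L¹`. -/
theorem tendsto_integral_abs_sub_of_tendsto_ae {ι : Type*} {l : Filter ι} [l.IsCountablyGenerated]
    {F : ι → Ω → ℝ} {f : Ω → ℝ} (hF : ∀ᶠ i in l, Integrable (F i) μ) (hf : Integrable f μ)
    (hF0 : ∀ᶠ i in l, 0 ≤ᵐ[μ] F i) (hf0 : 0 ≤ᵐ[μ] f)
    (hint : ∀ᶠ i in l, ∫ x, F i x ∂μ = ∫ x, f x ∂μ)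
    (hlim : ∀ᵐ x ∂μ, Filter.Tendsto (fun i => F i x) l (𝓝 (f x))) :
    Filter.Tendsto (fun i => ∫ x, |F i x - f x| ∂μ) l (𝓝 0) := by
  -- `|F - f| = (F - f) + 2 (f - F)⁺`. The first term integrates to zero by equality of masses, and
  -- `(f - F)⁺ ≤ f` allows dominated convergence.
  have hmain : Filter.Tendsto (fun i => 2 * ∫ x, max (f x - F i x) 0 ∂μ) l (𝓝 (2 * ∫ _, 0 ∂μ)) := by
    refine Filter.Tendsto.const_mul _ (tendsto_integral_filter_of_dominated_convergence f ?_ ?_ hf ?_)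
    · filter_upwards [hF] with i hi
      exact (hf.sub hi).pos_part.aestronglyMeasurable
    · filter_upwards [hF0] with i hi
      filter_upwards [hi, hf0] with x hx hx0
      simp only [Pi.zero_apply] at hx hx0
      rw [Real.norm_eq_abs, abs_of_nonneg (le_max_right _ _)]
      exact max_le (by linarith) hx0
    · filter_upwards [hlim] with x hx
      have := ((tendsto_const_nhds (x := f x)).sub hx).max (tendsto_const_nhds (x := (0 : ℝ)))
      simpa using this
  simp only [integral_zero, mul_zero] at hmain
  refine hmain.congr' ?_
  filter_upwards [hF, hint] with i hi hii
  have : ∀ x, |F i x - f x| = (F i x - f x) + 2 * max (f x - F i x) 0 := fun x => by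
    rcases le_total (F i x) (f x) with h | h
    · rw [abs_of_nonpos (by linarith), max_eq_left (by linarith)]
      ring
    · rw [abs_of_nonneg (by linarith), max_eq_right (by linarith)]
      ring
  simp only [this]
  have h1 : Integrable (fun x => F i x - f x) μ := hi.sub hf
  have h2 : Integrable (fun x => max (f x - F i x) 0) μ := (hf.sub hi).pos_part
  rw [integral_add h1 (h2.const_mul 2), integral_sub hi hf, hii, integral_const_mul, sub_self,
    zero_add]

/-- Normalised weights that are comparable up to a factor `exp a` are `4 a`-close in `L¹`. -/
theorem integral_abs_div_integral_sub_le {w w' : Ω → ℝ} (hw : Integrable w μ)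
    (hw' : Integrable w' μ) (h0 : ∀ x, 0 ≤ w x) (hZ : 0 < ∫ x, w x ∂μ)
    (hZ' : 0 < ∫ x, w' x ∂μ) {a : ℝ} (h : ∀ x, w x ≤ Real.exp a * w' x)
    (h' : ∀ x, w' x ≤ Real.exp a * w x) :
    ∫ x, |w x / (∫ y, w y ∂μ) - w' x / (∫ y, w' y ∂μ)| ∂μ ≤ 4 * a := by
  set Z := ∫ y, w y ∂μ with hZdef
  set Z' := ∫ y, w' y ∂μ with hZdef'
  have h0' : ∀ x, 0 ≤ w' x := fun x =>
    nonneg_of_mul_nonneg_right ((h0 x).trans (h x)) (Real.exp_pos a)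
  have hZZ : Z ≤ Real.exp a * Z' := by
    rw [hZdef, hZdef', ← integral_const_mul]
    exact integral_mono hw (hw'.const_mul _) h
  have hZZ' : Z' ≤ Real.exp a * Z := by
    rw [hZdef, hZdef', ← integral_const_mul]
    exact integral_mono hw' (hw.const_mul _) h'
  -- Weight and normalisation each cost a factor `exp a`, so `u' / V' ≥ exp (-2 a) (u / V) ≥ (1 - 2
  -- a) (u / V)`. Each of the two normalised weights has mass one, whence the constant `4 = 2 + 2`.
  have key : ∀ {u u' V V' : ℝ}, 0 ≤ u → 0 ≤ u' → 0 < V → 0 < V' → u ≤ Real.exp a * u' →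
      V' ≤ Real.exp a * V → u / V - u' / V' ≤ 2 * a * (u / V) := by
    intro u u' V V' hu hu' hV hV' huu hVV
    have hexp : 1 - 2 * a ≤ Real.exp (-(2 * a)) := by
      linarith [Real.add_one_le_exp (-(2 * a))]
    have hle : Real.exp (-(2 * a)) * (u / V) ≤ u' / V' := by
      rw [mul_div_assoc', div_le_div_iff₀ hV hV']
      calc Real.exp (-(2 * a)) * u * V'
          ≤ Real.exp (-(2 * a)) * (Real.exp a * u') * (Real.exp a * V) := by gcongr
        _ = (Real.exp (-(2 * a)) * Real.exp a * Real.exp a) * (u' * V) := by ring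
        _ = u' * V := by
          rw [← Real.exp_add, ← Real.exp_add]
          ring_nf
          simp
    have := mul_le_mul_of_nonneg_right hexp (div_nonneg hu hV.le)
    linarith
  have hpt : ∀ x, |w x / Z - w' x / Z'| ≤ 2 * a * (w x / Z) + 2 * a * (w' x / Z') := by
    intro x
    have h1 := key (h0 x) (h0' x) hZ hZ' (h x) hZZ'
    have h2 := key (h0' x) (h0 x) hZ' hZ (h' x) hZZ
    rcases le_total (w x / Z) (w' x / Z') with hle | hle
    · rw [abs_of_nonpos (by linarith)]
      -- The sign of `a` is not assumed; it is read off from the other term unless both quotients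
      -- vanish.
      have : 0 ≤ 2 * a * (w x / Z) := by
        have ha : 0 ≤ 2 * a * (w' x / Z') := by linarith
        rcases (div_nonneg (h0' x) hZ'.le).eq_or_lt with h3 | h3
        · rw [le_antisymm (h3 ▸ hle) (div_nonneg (h0 x) hZ.le), mul_zero]
        · exact mul_nonneg (nonneg_of_mul_nonneg_left ha h3) (div_nonneg (h0 x) hZ.le)
      linarith
    · rw [abs_of_nonneg (by linarith)]
      have : 0 ≤ 2 * a * (w' x / Z') := by
        have ha : 0 ≤ 2 * a * (w x / Z) := by linarith
        rcases (div_nonneg (h0 x) hZ.le).eq_or_lt with h3 | h3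
        · rw [le_antisymm (h3 ▸ hle) (div_nonneg (h0' x) hZ'.le), mul_zero]
        · exact mul_nonneg (nonneg_of_mul_nonneg_left ha h3) (div_nonneg (h0' x) hZ'.le)
      linarith
  have hi := hw.div_const Z
  have hi' := hw'.div_const Z'
  calc ∫ x, |w x / Z - w' x / Z'| ∂μ
      ≤ ∫ x, (2 * a * (w x / Z) + 2 * a * (w' x / Z')) ∂μ :=
        integral_mono (hi.sub hi').abs ((hi.const_mul _).add (hi'.const_mul _)) hpt
    _ = 4 * a := by
      rw [integral_add (hi.const_mul _) (hi'.const_mul _), integral_const_mul,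
        integral_const_mul, integral_div, integral_div, div_self hZ.ne', div_self hZ'.ne']
      ring

end TotalVariation

/-! ### Normalised powers of a bounded weight -/

section PowDensity

variable {Ω : Type*} [MeasurableSpace Ω]

/-- The probability density proportional to `g ^ p`. -/
noncomputable def powDensity (μ : Measure Ω) (g : Ω → ℝ) (p : ℝ) (x : Ω) : ℝ :=
  g x ^ p / ∫ y, g y ^ p ∂μ

/-- `g` is a measurable weight with values in `[0, B]`, not almost everywhere zero. -/
structure IsBoundedWeight (μ : Measure Ω) (g : Ω → ℝ) (B : ℝ) : Prop where
  measurable : Measurable g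
  nonneg : ∀ x, 0 ≤ g x
  le : ∀ x, g x ≤ B
  not_ae_zero : ¬ g =ᵐ[μ] 0

namespace IsBoundedWeight

variable {μ : Measure Ω} {g : Ω → ℝ} {B p : ℝ}

theorem measurable_powDensity (hg : IsBoundedWeight μ g B) : Measurable (powDensity μ g p) :=
  (hg.measurable.pow_const p).div_const _

theorem mul_exp_neg (hg : IsBoundedWeight μ g B) (k : boundedMeasurable Ω) :
    IsBoundedWeight μ (fun x => g x * Real.exp (-k x)) (B * Real.exp ‖k‖) where
  measurable := hg.measurable.mul (Real.measurable_exp.comp (boundedMeasurable.measurable k).neg)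
  nonneg x := mul_nonneg (hg.nonneg x) (Real.exp_pos _).le
  le x := by
    have := hg.nonneg x
    have h1 := hg.le x
    have h2 : -k x ≤ ‖k‖ := (neg_le_abs _).trans (boundedMeasurable.abs_apply_le k x)
    have h3 := this.trans h1
    gcongr
  not_ae_zero h := hg.not_ae_zero <| h.mono fun x hx =>
    (mul_eq_zero.1 hx).resolve_right (Real.exp_pos _).ne'

variable [IsFiniteMeasure μ]

theorem integrable_rpow (hg : IsBoundedWeight μ g B) (hp : 0 ≤ p) :
    Integrable (fun x => g x ^ p) μ := by
  refine Integrable.of_bound (hg.measurable.pow_const p).aestronglyMeasurable (B ^ p)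
    (.of_forall fun x => ?_)
  rw [Real.norm_eq_abs, abs_of_nonneg (Real.rpow_nonneg (hg.nonneg x) p)]
  exact Real.rpow_le_rpow (hg.nonneg x) (hg.le x) hp

theorem integral_rpow_pos (hg : IsBoundedWeight μ g B) (hp : 0 < p) :
    0 < ∫ x, g x ^ p ∂μ := by
  have h0 : ∀ x, 0 ≤ g x ^ p := fun x => Real.rpow_nonneg (hg.nonneg x) p
  refine (integral_nonneg h0).lt_of_ne' fun h => hg.not_ae_zero ?_
  filter_upwards [(integral_eq_zero_iff_of_nonneg h0 (hg.integrable_rpow hp.le)).1 h] with x hx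
  exact (Real.rpow_eq_zero (hg.nonneg x) hp.ne').1 hx

theorem powDensity_nonneg (hg : IsBoundedWeight μ g B) (hp : 0 < p) (x : Ω) :
    0 ≤ powDensity μ g p x :=
  div_nonneg (Real.rpow_nonneg (hg.nonneg x) p) (hg.integral_rpow_pos hp).le

theorem integral_powDensity (hg : IsBoundedWeight μ g B) (hp : 0 < p) :
    ∫ x, powDensity μ g p x ∂μ = 1 := by
  simp only [powDensity]
  rw [integral_div, div_self (hg.integral_rpow_pos hp).ne']

theorem integrable_powDensity (hg : IsBoundedWeight μ g B) (hp : 0 ≤ p) :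
    Integrable (powDensity μ g p) μ :=
  (hg.integrable_rpow hp).div_const _

theorem continuousAt_integral_rpow (hg : IsBoundedWeight μ g B) (hB : 1 ≤ B) (hp : 0 < p) :
    ContinuousAt (fun q => ∫ x, g x ^ q ∂μ) p := by
  -- For exponents `q` in `(0, p + 1)`, `1 ≤ B` gives `g ^ q ≤ B ^ q ≤ B ^ (p + 1)`.
  refine tendsto_integral_filter_of_dominated_convergence (fun _ => B ^ (p + 1))
    (.of_forall fun q => (hg.measurable.pow_const q).aestronglyMeasurable) ?_
    (integrable_const _) (.of_forall fun x => ?_)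
  · filter_upwards [lt_mem_nhds hp, gt_mem_nhds (lt_add_one p)] with q hq hq'
    refine .of_forall fun x => ?_
    rw [Real.norm_eq_abs, abs_of_nonneg (Real.rpow_nonneg (hg.nonneg x) q)]
    exact (Real.rpow_le_rpow (hg.nonneg x) (hg.le x) hq.le).trans
      (Real.rpow_le_rpow_of_exponent_le hB hq'.le)
  · exact Real.continuousAt_const_rpow' hp.ne'

theorem continuousAt_powDensity (hg : IsBoundedWeight μ g B) (hB : 1 ≤ B) (hp : 0 < p) (x : Ω) :
    ContinuousAt (fun q => powDensity μ g q x) p :=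
  (Real.continuousAt_const_rpow' hp.ne').div (hg.continuousAt_integral_rpow hB hp)
    (hg.integral_rpow_pos hp).ne'

theorem tendsto_integral_abs_powDensity_sub (hg : IsBoundedWeight μ g B) (hB : 1 ≤ B)
    (hp : 0 < p) :
    Filter.Tendsto (fun q => ∫ x, |powDensity μ g q x - powDensity μ g p x| ∂μ) (𝓝 p) (𝓝 0) := by
  have hpos := lt_mem_nhds hp
  refine tendsto_integral_abs_sub_of_tendsto_ae (hpos.mono fun q hq => hg.integrable_powDensity hq.le)
    (hg.integrable_powDensity hp.le) (hpos.mono fun q hq => .of_forall (hg.powDensity_nonneg hq))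
    (.of_forall (hg.powDensity_nonneg hp)) (hpos.mono fun q hq => ?_)
    (.of_forall fun x => hg.continuousAt_powDensity hB hp x)
  rw [hg.integral_powDensity hp, hg.integral_powDensity hq]

theorem exists_isDensity (hg : IsBoundedWeight μ g B) (hp : 0 < p) :
    ∃ m : ProbabilityMeasure Ω, IsDensity μ m (powDensity μ g p) :=
  _root_.exists_isDensity hg.measurable_powDensity (hg.powDensity_nonneg hp)
    (hg.integral_powDensity hp)

variable {k k' : boundedMeasurable Ω}

/-- The two unnormalised weights are comparable up to the factor `exp (p ‖k - k'‖)`. The factor `p`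
in the bound is essential for a Lipschitz constant uniform in time. -/
theorem integral_abs_powDensity_mul_exp_sub_le (hg : IsBoundedWeight μ g B) (hp : 0 < p) :
    ∫ x, |powDensity μ (fun x => g x * Real.exp (-k x)) p x -
      powDensity μ (fun x => g x * Real.exp (-k' x)) p x| ∂μ ≤ 4 * (p * ‖k - k'‖) := by
  have key : ∀ (k k' : boundedMeasurable Ω) (x : Ω), (g x * Real.exp (-k x)) ^ p ≤
      Real.exp (p * ‖k - k'‖) * (g x * Real.exp (-k' x)) ^ p := by
    intro k k' x
    have h1 : k' x - k x ≤ ‖k - k'‖ := by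
      rw [norm_sub_rev]
      exact (le_abs_self _).trans (boundedMeasurable.abs_sub_apply_le k' k x)
    rw [mul_comm p, Real.exp_mul, ← Real.mul_rpow (Real.exp_pos _).le
      (mul_nonneg (hg.nonneg x) (Real.exp_pos _).le)]
    refine Real.rpow_le_rpow (mul_nonneg (hg.nonneg x) (Real.exp_pos _).le) ?_ hp.le
    rw [mul_left_comm, ← Real.exp_add]
    exact mul_le_mul_of_nonneg_left (Real.exp_le_exp.2 (by linarith)) (hg.nonneg x)
  have hk := hg.mul_exp_neg k
  have hk' := hg.mul_exp_neg k'
  refine integral_abs_div_integral_sub_le (hk.integrable_rpow hp.le) (hk'.integrable_rpow hp.le)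
    (fun x => Real.rpow_nonneg (hk.nonneg x) p) (hk.integral_rpow_pos hp)
    (hk'.integral_rpow_pos hp) (key k k') ?_
  rw [norm_sub_rev]
  exact key k' k

end IsBoundedWeight

end PowDensity

/-! ### The flow of the log-density -/

section Flow

variable {d : ℕ} {F : ProbabilityMeasure (EuclideanSpace ℝ (Fin d)) → ℝ}
  {dF : ProbabilityMeasure (EuclideanSpace ℝ (Fin d)) → EuclideanSpace ℝ (Fin d) → ℝ}
  {d2F : ProbabilityMeasure (EuclideanSpace ℝ (Fin d)) →
    EuclideanSpace ℝ (Fin d) → EuclideanSpace ℝ (Fin d) → ℝ}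

namespace EnergyAssumption

/-- The flat derivative as a bounded measurable function of the space variable. -/
noncomputable def boundedDeriv (hF : EnergyAssumption F dF d2F)
    (m : ProbabilityMeasure (EuclideanSpace ℝ (Fin d))) :
    boundedMeasurable (EuclideanSpace ℝ (Fin d)) :=
  boundedMeasurable.mk (dF m) (hF.first.measurable m)
    (let ⟨C, _, hC⟩ := hF.bound_first; ⟨C, hC m⟩)

@[simp]
theorem boundedDeriv_apply (hF : EnergyAssumption F dF d2F)
    (m : ProbabilityMeasure (EuclideanSpace ℝ (Fin d))) (x : EuclideanSpace ℝ (Fin d)) :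
    hF.boundedDeriv m x = dF m x := rfl

theorem exists_norm_boundedDeriv_le (hF : EnergyAssumption F dF d2F) :
    ∃ C : ℝ≥0, ∀ m, ‖hF.boundedDeriv m‖ ≤ C := by
  obtain ⟨C, hC0, hC⟩ := hF.bound_first
  exact ⟨⟨C, hC0.le⟩, fun m => boundedMeasurable.norm_le hC0.le (hC m)⟩

/-- The flat derivative is Lipschitz in total variation, uniformly in space. -/
theorem exists_norm_boundedDeriv_sub_le (hF : EnergyAssumption F dF d2F) :
    ∃ K : ℝ≥0, ∀ (μ : Measure (EuclideanSpace ℝ (Fin d)))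
      (m m' : ProbabilityMeasure (EuclideanSpace ℝ (Fin d)))
      (f f' : EuclideanSpace ℝ (Fin d) → ℝ), IsDensity μ m f → IsDensity μ m' f' →
      ‖hF.boundedDeriv m' - hF.boundedDeriv m‖ ≤ K * ∫ x, |f' x - f x| ∂μ := by
  obtain ⟨C, hC0, hC⟩ := hF.bound_second
  refine ⟨⟨C, hC0.le⟩, fun μ m m' f f' h h' => boundedMeasurable.norm_le
    (mul_nonneg hC0.le (integral_nonneg fun _ => abs_nonneg _)) fun x => ?_⟩
  exact (hF.second x).abs_sub_le h h' fun m y => hC m x y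

variable {μ : Measure (EuclideanSpace ℝ (Fin d))} [IsFiniteMeasure μ]
  {g : EuclideanSpace ℝ (Fin d) → ℝ} {B s : ℝ}
  {M : ℝ → boundedMeasurable (EuclideanSpace ℝ (Fin d)) →
    ProbabilityMeasure (EuclideanSpace ℝ (Fin d))}

/-- The growth `exp (s t)` of the field is compensated by the exponent `exp (-(s t))` in the total
variation estimate, leaving four times the Lipschitz constant of the flat derivative at every time.
-/
theorem exists_lipschitzWith (hF : EnergyAssumption F dF d2F) (hg : IsBoundedWeight μ g B)
    (hM : ∀ t k, IsDensity μ (M t k)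
      (powDensity μ (fun x => g x * Real.exp (-k x)) (Real.exp (-(s * t))))) :
    ∃ K : ℝ≥0, ∀ t, LipschitzWith K fun k => Real.exp (s * t) • hF.boundedDeriv (M t k) := by
  obtain ⟨K, hK⟩ := hF.exists_norm_boundedDeriv_sub_le
  refine ⟨K * 4, fun t => LipschitzWith.of_dist_le_mul fun k k' => ?_⟩
  rw [dist_eq_norm, dist_eq_norm, ← smul_sub, norm_smul, Real.norm_eq_abs, Real.abs_exp]
  calc Real.exp (s * t) * ‖hF.boundedDeriv (M t k) - hF.boundedDeriv (M t k')‖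
      ≤ Real.exp (s * t) * (K * (4 * (Real.exp (-(s * t)) * ‖k - k'‖))) := by
        gcongr
        refine (hK μ _ _ _ _ (hM t k') (hM t k)).trans ?_
        gcongr
        exact hg.integral_abs_powDensity_mul_exp_sub_le (Real.exp_pos _)
    _ = (Real.exp (s * t) * Real.exp (-(s * t))) * (K * 4 * ‖k - k'‖) := by ring
    _ = ((K * 4 : ℝ≥0) : ℝ) * ‖k - k'‖ := by
        rw [← Real.exp_add, add_neg_cancel, Real.exp_zero, one_mul]
        push_cast
        ring

/-- For fixed `k` only the exponent varies with time; normalised powers depend continuously on it in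
`L¹` by Scheffé's lemma. -/
theorem continuous_boundedDeriv (hF : EnergyAssumption F dF d2F) (hg : IsBoundedWeight μ g B)
    (hB : 1 ≤ B) (hM : ∀ t k, IsDensity μ (M t k)
      (powDensity μ (fun x => g x * Real.exp (-k x)) (Real.exp (-(s * t)))))
    (k : boundedMeasurable (EuclideanSpace ℝ (Fin d))) :
    Continuous fun t => hF.boundedDeriv (M t k) := by
  obtain ⟨K, hK⟩ := hF.exists_norm_boundedDeriv_sub_le
  have hB' : 1 ≤ B * Real.exp ‖k‖ :=
    one_le_mul_of_one_le_of_one_le hB (Real.one_le_exp (norm_nonneg k))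
  refine continuous_iff_continuousAt.2 fun t => ?_
  rw [ContinuousAt, tendsto_iff_norm_sub_tendsto_zero]
  refine squeeze_zero (fun _ => norm_nonneg _) (fun t' => hK μ _ _ _ _ (hM t k) (hM t' k)) ?_
  have h1 := (hg.mul_exp_neg k).tendsto_integral_abs_powDensity_sub hB' (Real.exp_pos (-(s * t)))
  have h2 : Filter.Tendsto (fun t' => Real.exp (-(s * t'))) (𝓝 t) (𝓝 (Real.exp (-(s * t)))) :=
    Continuous.tendsto (by fun_prop) t
  simpa using (h1.comp h2).const_mul (K : ℝ)

theorem exists_flow (hF : EnergyAssumption F dF d2F) (hg : IsBoundedWeight μ g B)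
    (hB : 1 ≤ B) (hM : ∀ t k, IsDensity μ (M t k)
      (powDensity μ (fun x => g x * Real.exp (-k x)) (Real.exp (-(s * t))))) :
    ∃ k : ℝ → boundedMeasurable (EuclideanSpace ℝ (Fin d)), k 0 = 0 ∧
      ∀ t, HasDerivAt k (Real.exp (s * t) • hF.boundedDeriv (M t (k t))) t := by
  obtain ⟨K, hK⟩ := hF.exists_lipschitzWith hg hM
  obtain ⟨C, hC⟩ := hF.exists_norm_boundedDeriv_le
  have hexp : Continuous fun t : ℝ => Real.exp (s * t) := by fun_prop
  refine exists_forall_hasDerivAt_of_lipschitzWith hK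
    (fun k => hexp.smul (hF.continuous_boundedDeriv hg hB hM k)) (fun T => ?_) 0
  refine ⟨⟨Real.exp (|s| * T), (Real.exp_pos _).le⟩ * C, fun t ht k => ?_⟩
  rw [norm_smul, Real.norm_eq_abs, Real.abs_exp]
  have : s * t ≤ |s| * T := (le_abs_self _).trans
    (by rw [abs_mul]; exact mul_le_mul_of_nonneg_left (abs_le.2 ht) (abs_nonneg s))
  exact mul_le_mul (Real.exp_le_exp.2 this) (hC _) (norm_nonneg _) (Real.exp_pos _).le

end EnergyAssumption

end Flow

/-! ### Locally bounded curves of functions -/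

section LocallyBounded

variable {Ω : Type*}

/-- `φ t x` is bounded, uniformly in `x`, for `t` in bounded sets. -/
def IsLocallyBounded (φ : ℝ → Ω → ℝ) : Prop :=
  ∀ T : ℝ, ∃ M, ∀ t, |t| ≤ T → ∀ x, |φ t x| ≤ M

namespace IsLocallyBounded

variable {φ ψ : ℝ → Ω → ℝ}

theorem of_forall_abs_le {C : ℝ} (h : ∀ t x, |φ t x| ≤ C) : IsLocallyBounded φ :=
  fun _ => ⟨C, fun t _ x => h t x⟩

theorem of_continuous {c : ℝ → ℝ} (hc : Continuous c) :
    IsLocallyBounded fun t (_ : Ω) => c t := fun T => by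
  obtain ⟨M, hM⟩ := (isCompact_Icc (a := -T) (b := T)).exists_bound_of_continuousOn hc.continuousOn
  exact ⟨M, fun t ht _ => hM t (abs_le.1 ht)⟩

theorem add (hφ : IsLocallyBounded φ) (hψ : IsLocallyBounded ψ) :
    IsLocallyBounded fun t x => φ t x + ψ t x := fun T => by
  obtain ⟨M, hM⟩ := hφ T
  obtain ⟨N, hN⟩ := hψ T
  exact ⟨M + N, fun t ht x => (abs_add_le _ _).trans (add_le_add (hM t ht x) (hN t ht x))⟩

theorem mul (hφ : IsLocallyBounded φ) (hψ : IsLocallyBounded ψ) :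
    IsLocallyBounded fun t x => φ t x * ψ t x := fun T => by
  obtain ⟨M, hM⟩ := hφ T
  obtain ⟨N, hN⟩ := hψ T
  refine ⟨M * N, fun t ht x => ?_⟩
  rw [abs_mul]
  exact mul_le_mul (hM t ht x) (hN t ht x) (abs_nonneg _) ((abs_nonneg _).trans (hM t ht x))

theorem const_mul (c : ℝ) (hφ : IsLocallyBounded φ) : IsLocallyBounded fun t x => c * φ t x :=
  (of_continuous (continuous_const (y := c))).mul hφ

theorem neg (hφ : IsLocallyBounded φ) : IsLocallyBounded fun t x => -φ t x := by
  simpa using hφ.const_mul (-1)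

theorem continuous_comp (hφ : IsLocallyBounded φ) (h0 : ∀ t x, 0 ≤ φ t x) {u : ℝ → ℝ}
    (hu : Continuous u) : IsLocallyBounded fun t x => u (φ t x) := fun T => by
  obtain ⟨M, hM⟩ := hφ T
  obtain ⟨N, hN⟩ := (isCompact_Icc (a := (0 : ℝ)) (b := M)).exists_bound_of_continuousOn
    hu.continuousOn
  exact ⟨N, fun t ht x => hN _ ⟨h0 t x, (le_abs_self _).trans (hM t ht x)⟩⟩

theorem mul_log (hφ : IsLocallyBounded φ) (h0 : ∀ t x, 0 ≤ φ t x) :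
    IsLocallyBounded fun t x => φ t x * Real.log (φ t x) :=
  hφ.continuous_comp h0 Real.continuous_mul_log

theorem mul_log_sq (hφ : IsLocallyBounded φ) (h0 : ∀ t x, 0 ≤ φ t x) :
    IsLocallyBounded fun t x => φ t x * Real.log (φ t x) ^ 2 := by
  -- `y log² y = 4 (√y log √y)²` for `y ≥ 0`, which extends continuously through `y = 0`.
  have hu : Continuous fun y => 4 * (√y * Real.log √y) ^ 2 :=
    continuous_const.mul ((Real.continuous_mul_log.comp Real.continuous_sqrt).pow 2)
  convert hφ.continuous_comp h0 hu using 3 with t x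
  rw [mul_pow, Real.sq_sqrt (h0 t x), Real.log_sqrt (h0 t x)]
  ring

variable [MeasurableSpace Ω] {μ : Measure Ω} [IsFiniteMeasure μ]

theorem integrable (hφ : IsLocallyBounded φ) (hm : ∀ t, Measurable (φ t)) (t : ℝ) :
    Integrable (φ t) μ := by
  obtain ⟨M, hM⟩ := hφ |t|
  exact Integrable.of_bound (hm t).aestronglyMeasurable M (.of_forall (hM t le_rfl))

theorem hasDerivAt_integral (hψ : IsLocallyBounded ψ) (hm : ∀ t, Measurable (φ t))
    (hi : ∀ t, Integrable (φ t) μ) (hm' : ∀ t, Measurable (ψ t))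
    (hd : ∀ x t, HasDerivAt (fun s => φ s x) (ψ t x) t) (t : ℝ) :
    HasDerivAt (fun s => ∫ x, φ s x ∂μ) (∫ x, ψ t x ∂μ) t := by
  obtain ⟨M, hM⟩ := hψ (|t| + 1)
  have hs : {r : ℝ | |r| ≤ |t| + 1} ∈ 𝓝 t := by
    filter_upwards [continuous_abs.continuousAt.eventually (gt_mem_nhds (lt_add_one |t|))] with r hr
    exact hr.le
  exact (hasDerivAt_integral_of_dominated_loc_of_deriv_le (bound := fun _ => M) hs
    (.of_forall fun r => (hm r).aestronglyMeasurable) (hi t) (hm' t).aestronglyMeasurable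
    (.of_forall fun x r hr => hM r hr x) (integrable_const _)
    (.of_forall fun x r _ => hd x r)).2

end IsLocallyBounded

end LocallyBounded

/-! ### The equation for the normalised density -/

section Replicator

variable {d : ℕ} {F : ProbabilityMeasure (EuclideanSpace ℝ (Fin d)) → ℝ}
  {dF : ProbabilityMeasure (EuclideanSpace ℝ (Fin d)) → EuclideanSpace ℝ (Fin d) → ℝ}
  {d2F : ProbabilityMeasure (EuclideanSpace ℝ (Fin d)) →
    EuclideanSpace ℝ (Fin d) → EuclideanSpace ℝ (Fin d) → ℝ}
  {μ : Measure (EuclideanSpace ℝ (Fin d))} {s : ℝ}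
  {m : ℝ → ProbabilityMeasure (EuclideanSpace ℝ (Fin d))}

/-- The rate of the birth-death equation in terms of a density `f` with respect to the reference
measure `μ`. -/
noncomputable def replicatorRate
    (dF : ProbabilityMeasure (EuclideanSpace ℝ (Fin d)) → EuclideanSpace ℝ (Fin d) → ℝ)
    (μ : Measure (EuclideanSpace ℝ (Fin d))) (s : ℝ)
    (m : ProbabilityMeasure (EuclideanSpace ℝ (Fin d))) (f : EuclideanSpace ℝ (Fin d) → ℝ)
    (x : EuclideanSpace ℝ (Fin d)) : ℝ :=
  dF m x + s * Real.log (f x) - s * ∫ y, f y * Real.log (f y) ∂μ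

/-- A locally bounded curve of probability densities that solves the birth-death equation at every
point and at all times. -/
structure IsReplicatorFlow
    (dF : ProbabilityMeasure (EuclideanSpace ℝ (Fin d)) → EuclideanSpace ℝ (Fin d) → ℝ)
    (μ : Measure (EuclideanSpace ℝ (Fin d))) (s : ℝ)
    (m : ℝ → ProbabilityMeasure (EuclideanSpace ℝ (Fin d)))
    (f : ℝ → EuclideanSpace ℝ (Fin d) → ℝ) : Prop where
  density : ∀ t, IsDensity μ (m t) (f t)
  locallyBounded : IsLocallyBounded f
  eq_zero_or_pos : ∀ x, (∀ t, f t x = 0) ∨ ∀ t, 0 < f t x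
  equation : ∀ x t, HasDerivAt (fun r => f r x) (-(replicatorRate dF μ s (m t) (f t) x) * f t x) t

theorem EnergyAssumption.integral_density_mul_eq_zero (hF : EnergyAssumption F dF d2F)
    {m : ProbabilityMeasure (EuclideanSpace ℝ (Fin d))} {f : EuclideanSpace ℝ (Fin d) → ℝ}
    (h : IsDensity μ m f) : ∫ x, f x * dF m x ∂μ = 0 := by
  rw [← h.integral_eq, hF.normalised]

section Construction

variable {g : EuclideanSpace ℝ (Fin d) → ℝ} {B : ℝ}
  {k : ℝ → boundedMeasurable (EuclideanSpace ℝ (Fin d))}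

/-- Where `g > 0`, the logarithm of the weight is `(log g - k) exp (-s t)`, and the factor `exp (s
t)` in `k'` cancels. Where `g = 0`, the weight vanishes at all times because the exponent is
positive. -/
theorem EnergyAssumption.hasDerivAt_weight (hF : EnergyAssumption F dF d2F)
    (hg : IsBoundedWeight μ g B)
    (hk : ∀ t, HasDerivAt k (Real.exp (s * t) • hF.boundedDeriv (m t)) t)
    (x : EuclideanSpace ℝ (Fin d)) (t : ℝ) :
    HasDerivAt (fun r => (g x * Real.exp (-k r x)) ^ Real.exp (-(s * r)))
      (-(s * Real.log ((g x * Real.exp (-k t x)) ^ Real.exp (-(s * t))) + dF (m t) x) *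
        (g x * Real.exp (-k t x)) ^ Real.exp (-(s * t))) t := by
  rcases (hg.nonneg x).eq_or_lt with h0 | h0
  · have : ∀ r : ℝ, (g x * Real.exp (-k r x)) ^ Real.exp (-(s * r)) = 0 := fun r => by
      rw [← h0, zero_mul, Real.zero_rpow (Real.exp_pos _).ne']
    simp only [this, mul_zero]
    exact hasDerivAt_const t 0
  · have heq : ∀ r : ℝ, (g x * Real.exp (-k r x)) ^ Real.exp (-(s * r)) =
        Real.exp ((Real.log (g x) - k r x) * Real.exp (-(s * r))) := fun r => by
      rw [Real.rpow_def_of_pos (mul_pos h0 (Real.exp_pos _)),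
        Real.log_mul h0.ne' (Real.exp_pos _).ne', Real.log_exp, sub_eq_add_neg]
    simp only [heq, Real.log_exp]
    have h1 := boundedMeasurable.hasDerivAt_apply (hk t) x
    have h2 : HasDerivAt (fun r => Real.exp (-(s * r))) (Real.exp (-(s * t)) * (-(s * 1))) t :=
      ((hasDerivAt_id t).const_mul s).neg.exp
    have h3 := (((hasDerivAt_const t (Real.log (g x))).sub h1).mul h2).exp
    refine h3.congr_deriv ?_
    have hee : Real.exp (s * t) * Real.exp (-(s * t)) = 1 := by
      rw [← Real.exp_add, add_neg_cancel, Real.exp_zero]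
    simp only [Pi.mul_apply, Pi.sub_apply, boundedMeasurable.smul_apply, hF.boundedDeriv_apply]
    linear_combination (-dF (m t) x *
      Real.exp ((Real.log (g x) - k t x) * Real.exp (-(s * t)))) * hee

/-- With `f = h / Z`, the logarithmic derivative of `f` is that of `h` minus `Z' / Z`. Here `Z' = -s
∫ h log h`, since `∫ h dF = 0`, and the terms `log Z` coming from `log f` and from the entropy of
`f` cancel. -/
theorem EnergyAssumption.isReplicatorFlow [IsFiniteMeasure μ] (hF : EnergyAssumption F dF d2F)
    (hg : IsBoundedWeight μ g B) (hB : 1 ≤ B)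
    (hk : ∀ t, HasDerivAt k (Real.exp (s * t) • hF.boundedDeriv (m t)) t)
    (hm : ∀ t, IsDensity μ (m t)
      (powDensity μ (fun x => g x * Real.exp (-k t x)) (Real.exp (-(s * t))))) :
    IsReplicatorFlow dF μ s m
      fun t => powDensity μ (fun x => g x * Real.exp (-k t x)) (Real.exp (-(s * t))) := by
  set h : ℝ → EuclideanSpace ℝ (Fin d) → ℝ :=
    fun t x => (g x * Real.exp (-k t x)) ^ Real.exp (-(s * t)) with hh
  set Z : ℝ → ℝ := fun t => ∫ x, h t x ∂μ with hZ
  have hw := fun t => hg.mul_exp_neg (k t)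
  have h0 : ∀ t x, 0 ≤ h t x := fun t x => Real.rpow_nonneg ((hw t).nonneg x) _
  have hmeas : ∀ t, Measurable (h t) := fun t => (hw t).measurable.pow_const _
  have hZpos : ∀ t, 0 < Z t := fun t => (hw t).integral_rpow_pos (Real.exp_pos _)
  have hkc : Continuous k := continuous_iff_continuousAt.2 fun t => (hk t).continuousAt
  have hbdd : IsLocallyBounded h := by
    have hc : Continuous fun t => (B * Real.exp ‖k t‖) ^ Real.exp (-(s * t)) := by
      refine Continuous.rpow (by fun_prop) (by fun_prop) fun t => Or.inl ?_
      have := Real.exp_pos ‖k t‖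
      positivity
    intro T
    obtain ⟨N, hN⟩ := IsLocallyBounded.of_continuous (Ω := Unit) hc T
    refine ⟨N, fun t ht x => ?_⟩
    rw [abs_of_nonneg (h0 t x)]
    exact (Real.rpow_le_rpow ((hw t).nonneg x) ((hw t).le x) (Real.exp_pos _).le).trans
      ((le_abs_self _).trans (hN t ht ()))
  have hb : IsLocallyBounded fun t x => dF (m t) x := by
    obtain ⟨C, -, hC⟩ := hF.bound_first
    exact .of_forall_abs_le fun t x => hC (m t) x
  have hbm : ∀ t, Measurable (dF (m t)) := fun t => hF.first.measurable (m t)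
  have hder := hF.hasDerivAt_weight hg hk
  have hderB : IsLocallyBounded fun t x => -(s * Real.log (h t x) + dF (m t) x) * h t x := by
    convert ((hbdd.mul_log h0).const_mul (-s)).add (hb.mul hbdd).neg using 3
    ring
  have hZder : ∀ t, HasDerivAt Z (∫ x, -(s * Real.log (h t x) + dF (m t) x) * h t x ∂μ) t :=
    hderB.hasDerivAt_integral hmeas (hbdd.integrable hmeas)
      (fun t => (((Real.measurable_log.comp (hmeas t)).const_mul s).add (hbm t)).neg.mul (hmeas t))
      hder
  have hZc : Continuous Z := continuous_iff_continuousAt.2 fun t => (hZder t).continuousAt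
  have hf : ∀ t x, powDensity μ (fun x => g x * Real.exp (-k t x)) (Real.exp (-(s * t))) x =
      h t x / Z t := fun t x => rfl
  have hzero : ∀ x t, g x = 0 → h t x = 0 := fun x t hx => by
    simp only [hh]
    rw [hx, zero_mul, Real.zero_rpow (Real.exp_pos _).ne']
  refine ⟨hm, ?_, fun x => ?_, fun x t => ?_⟩
  · have := (IsLocallyBounded.of_continuous (Ω := EuclideanSpace ℝ (Fin d))
      (hZc.inv₀ fun t => (hZpos t).ne')).mul hbdd
    convert this using 3 with t x
    rw [hf, div_eq_inv_mul, Pi.inv_apply]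
  · rcases (hg.nonneg x).eq_or_lt with hx | hx
    · exact Or.inl fun t => by rw [hf, hzero x t hx.symm, zero_div]
    · exact Or.inr fun t => by
        rw [hf]
        exact div_pos (Real.rpow_pos_of_pos (mul_pos hx (Real.exp_pos _)) _) (hZpos t)
  · have hlogi : Integrable (fun y => h t y * Real.log (h t y)) μ :=
      (hbdd.mul_log h0).integrable (fun t => (hmeas t).mul (Real.measurable_log.comp (hmeas t))) t
    have hfi := (hm t).integrable
    have hdFi : Integrable (fun y => h t y * dF (m t) y) μ :=
      (hbdd.mul hb).integrable (fun t => (hmeas t).mul (hbm t)) t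
    have hflog : ∀ y, h t y / Z t * Real.log (h t y / Z t) =
        (Z t)⁻¹ * (h t y * Real.log (h t y)) - (Z t)⁻¹ * Real.log (Z t) * h t y := fun y => by
      rcases (h0 t y).eq_or_lt with hy | hy
      · rw [← hy]
        simp
      · rw [Real.log_div hy.ne' (hZpos t).ne']
        ring
    have hent : ∫ y, h t y / Z t * Real.log (h t y / Z t) ∂μ =
        (Z t)⁻¹ * (∫ y, h t y * Real.log (h t y) ∂μ) - Real.log (Z t) := by
      simp only [hflog]
      rw [integral_sub (hlogi.const_mul _) ((hbdd.integrable hmeas t).const_mul _),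
        integral_const_mul, integral_const_mul]
      change _ - (Z t)⁻¹ * Real.log (Z t) * Z t = _
      field_simp [(hZpos t).ne']
    have hnorm : ∫ y, h t y * dF (m t) y ∂μ = 0 := by
      have h1 := hF.integral_density_mul_eq_zero (hm t)
      have h2 : ∀ y, h t y * dF (m t) y = Z t * (h t y / Z t * dF (m t) y) := fun y => by
        field_simp [(hZpos t).ne']
      simp only [h2]
      rw [integral_const_mul]
      simp only [hf] at h1
      rw [h1, mul_zero]
    have hZ' : ∫ y, -(s * Real.log (h t y) + dF (m t) y) * h t y ∂μ =
        -s * ∫ y, h t y * Real.log (h t y) ∂μ := by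
      have : ∀ y, -(s * Real.log (h t y) + dF (m t) y) * h t y =
          -s * (h t y * Real.log (h t y)) - h t y * dF (m t) y := fun y => by ring
      simp only [this]
      rw [integral_sub (hlogi.const_mul _) hdFi, integral_const_mul, hnorm, sub_zero]
    have hq := (hder x t).div (hZder t) (hZpos t).ne'
    refine hq.congr_deriv ?_
    rw [hZ']
    simp only [replicatorRate, hf]
    rw [hent]
    change (-(s * Real.log (h t x) + dF (m t) x) * h t x * Z t - h t x *
      (-s * ∫ y, h t y * Real.log (h t y) ∂μ)) / Z t ^ 2 = _
    rcases (h0 t x).eq_or_lt with hx | hx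
    · rw [← hx]
      simp
    · rw [Real.log_div hx.ne' (hZpos t).ne']
      field_simp [(hZpos t).ne']
      ring

end Construction

end Replicator

/-! ### Energy dissipation -/

section Dissipation

variable {d : ℕ} {F : ProbabilityMeasure (EuclideanSpace ℝ (Fin d)) → ℝ}
  {dF : ProbabilityMeasure (EuclideanSpace ℝ (Fin d)) → EuclideanSpace ℝ (Fin d) → ℝ}
  {d2F : ProbabilityMeasure (EuclideanSpace ℝ (Fin d)) →
    EuclideanSpace ℝ (Fin d) → EuclideanSpace ℝ (Fin d) → ℝ}
  {μ : Measure (EuclideanSpace ℝ (Fin d))} {s : ℝ}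
  {m : ℝ → ProbabilityMeasure (EuclideanSpace ℝ (Fin d))}
  {f : ℝ → EuclideanSpace ℝ (Fin d) → ℝ}

/-- One factor `a` is expanded: the three terms match the derivative of `F`, the derivative of the
entropy, and a multiple of the mean of `a`, which is zero. -/
theorem replicatorRate_sq_mul (m : ProbabilityMeasure (EuclideanSpace ℝ (Fin d)))
    (f : EuclideanSpace ℝ (Fin d) → ℝ) (x : EuclideanSpace ℝ (Fin d)) :
    replicatorRate dF μ s m f x ^ 2 * f x =
      replicatorRate dF μ s m f x * f x * dF m x +
      s * (replicatorRate dF μ s m f x * f x * Real.log (f x)) -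
      s * (∫ y, f y * Real.log (f y) ∂μ) * (replicatorRate dF μ s m f x * f x) := by
  simp only [replicatorRate]
  ring

namespace IsReplicatorFlow

theorem measurable_replicatorRate (hF : EnergyAssumption F dF d2F)
    (hf : IsReplicatorFlow dF μ s m f) (t : ℝ) :
    Measurable (replicatorRate dF μ s (m t) (f t)) :=
  ((hF.first.measurable _).add ((Real.measurable_log.comp (hf.density t).measurable).const_mul
    s)).sub_const _

theorem isLocallyBounded_first (hF : EnergyAssumption F dF d2F) :
    IsLocallyBounded fun t x => dF (m t) x := by
  obtain ⟨C, -, hC⟩ := hF.bound_first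
  exact .of_forall_abs_le fun t x => hC (m t) x

variable [IsFiniteMeasure μ]

theorem integrable_mul_log (hf : IsReplicatorFlow dF μ s m f) (t : ℝ) :
    Integrable (fun x => f t x * Real.log (f t x)) μ :=
  (hf.locallyBounded.mul_log fun t => (hf.density t).nonneg).integrable
    (fun t => (hf.density t).measurable.mul (Real.measurable_log.comp (hf.density t).measurable)) t

theorem isLocallyBounded_entropy (hf : IsReplicatorFlow dF μ s m f) :
    IsLocallyBounded fun t (_ : EuclideanSpace ℝ (Fin d)) =>
      ∫ y, f t y * Real.log (f t y) ∂μ := fun T => by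
  obtain ⟨N, hN⟩ := hf.locallyBounded.mul_log (fun t => (hf.density t).nonneg) T
  refine ⟨N * μ.real Set.univ, fun t ht _ => ?_⟩
  rw [← Real.norm_eq_abs]
  exact norm_integral_le_of_norm_le_const (.of_forall fun y => hN t ht y)

theorem isLocallyBounded_rate_mul (hF : EnergyAssumption F dF d2F)
    (hf : IsReplicatorFlow dF μ s m f) :
    IsLocallyBounded fun t x => replicatorRate dF μ s (m t) (f t) x * f t x := by
  convert (((isLocallyBounded_first (m := m) hF).mul hf.locallyBounded).add
    ((hf.locallyBounded.mul_log fun t => (hf.density t).nonneg).const_mul s)).add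
    ((hf.isLocallyBounded_entropy.mul hf.locallyBounded).const_mul (-s)) using 3
  rw [replicatorRate]
  ring

theorem isLocallyBounded_rate_mul_mul_log (hF : EnergyAssumption F dF d2F)
    (hf : IsReplicatorFlow dF μ s m f) :
    IsLocallyBounded fun t x => replicatorRate dF μ s (m t) (f t) x * f t x * Real.log (f t x) := by
  have h0 : ∀ t x, 0 ≤ f t x := fun t => (hf.density t).nonneg
  convert (((isLocallyBounded_first (m := m) hF).mul (hf.locallyBounded.mul_log h0)).add
    ((hf.locallyBounded.mul_log_sq h0).const_mul s)).add
    ((hf.isLocallyBounded_entropy.mul (hf.locallyBounded.mul_log h0)).const_mul (-s)) using 3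
  rw [replicatorRate]
  ring

theorem integrable_rate_mul (hF : EnergyAssumption F dF d2F)
    (hf : IsReplicatorFlow dF μ s m f) (t : ℝ) :
    Integrable (fun x => replicatorRate dF μ s (m t) (f t) x * f t x) μ :=
  (hf.isLocallyBounded_rate_mul hF).integrable
    (fun t => (hf.measurable_replicatorRate hF t).mul (hf.density t).measurable) t

theorem integrable_rate_mul_mul_log (hF : EnergyAssumption F dF d2F)
    (hf : IsReplicatorFlow dF μ s m f) (t : ℝ) :
    Integrable (fun x => replicatorRate dF μ s (m t) (f t) x * f t x * Real.log (f t x)) μ :=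
  (hf.isLocallyBounded_rate_mul_mul_log hF).integrable
    (fun t => ((hf.measurable_replicatorRate hF t).mul (hf.density t).measurable).mul
      (Real.measurable_log.comp (hf.density t).measurable)) t

theorem integrable_rate_mul_first (hF : EnergyAssumption F dF d2F)
    (hf : IsReplicatorFlow dF μ s m f) (t : ℝ) :
    Integrable (fun x => replicatorRate dF μ s (m t) (f t) x * f t x * dF (m t) x) μ := by
  obtain ⟨C, -, hC⟩ := hF.bound_first
  exact (hf.integrable_rate_mul hF t).mul_bdd (hF.first.measurable _).aestronglyMeasurable
    (.of_forall (hC (m t)))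

/-- The birth-death rate has mean zero. -/
theorem integral_rate_mul (hF : EnergyAssumption F dF d2F)
    (hf : IsReplicatorFlow dF μ s m f) (t : ℝ) :
    ∫ x, replicatorRate dF μ s (m t) (f t) x * f t x ∂μ = 0 := by
  obtain ⟨C, -, hC⟩ := hF.bound_first
  have h1 := (hf.density t).integrable_mul (hF.first.measurable (m t)) (hC (m t))
  have h2 := hf.integrable_mul_log t
  have : ∀ x, replicatorRate dF μ s (m t) (f t) x * f t x = f t x * dF (m t) x +
      s * (f t x * Real.log (f t x)) - s * (∫ y, f t y * Real.log (f t y) ∂μ) * f t x := fun x => by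
    rw [replicatorRate]
    ring
  simp only [this]
  have h3 : Integrable (fun x => f t x * dF (m t) x + s * (f t x * Real.log (f t x))) μ :=
    h1.add (h2.const_mul s)
  rw [integral_sub h3 ((hf.density t).integrable.const_mul _),
    integral_add h1 (h2.const_mul s), integral_const_mul, integral_const_mul,
    (hf.density t).integral_eq_one, hF.integral_density_mul_eq_zero (hf.density t)]
  ring

/-- `(y log y)' = (1 + log y) y'`, and the contribution of `1` vanishes by conservation of mass.
Since `y log y` is not differentiable at `0`, points where the density is identically zero in time
are separated from those where it stays positive. -/
theorem hasDerivAt_entropy (hF : EnergyAssumption F dF d2F)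
    (hf : IsReplicatorFlow dF μ s m f) (t : ℝ) :
    HasDerivAt (fun r => ∫ x, f r x * Real.log (f r x) ∂μ)
      (-∫ x, replicatorRate dF μ s (m t) (f t) x * f t x * Real.log (f t x) ∂μ) t := by
  have hlb := ((hf.isLocallyBounded_rate_mul hF).add (hf.isLocallyBounded_rate_mul_mul_log hF)).neg
  have hmeas : ∀ t, Measurable fun x => replicatorRate dF μ s (m t) (f t) x * f t x := fun t =>
    (hf.measurable_replicatorRate hF t).mul (hf.density t).measurable
  have hlog : ∀ t, Measurable fun x => Real.log (f t x) := fun t =>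
    Real.measurable_log.comp (hf.density t).measurable
  have := hlb.hasDerivAt_integral (μ := μ) (φ := fun t x => f t x * Real.log (f t x))
    (fun t => (hf.density t).measurable.mul (hlog t)) hf.integrable_mul_log
    (fun t => ((hmeas t).add ((hmeas t).mul (hlog t))).neg) (fun x t => ?_) t
  · refine this.congr_deriv ?_
    rw [integral_neg, integral_add (hf.integrable_rate_mul hF t)
      (hf.integrable_rate_mul_mul_log hF t), hf.integral_rate_mul hF, zero_add]
  · rcases hf.eq_zero_or_pos x with h | h
    · simp only [h, zero_mul, mul_zero, add_zero, neg_zero]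
      exact hasDerivAt_const t 0
    · have h1 := hf.equation x t
      refine (h1.mul (h1.log (h t).ne')).congr_deriv ?_
      field_simp [(h t).ne']
      ring

/-- Linearise `F` at `m t`. The linear part is differentiated under the integral. In the remainder,
`dF` along the mixtures differs from `dF (m t)` by at most `K` times the total variation, so the
remainder is at most `K` times its square; as the curve is locally Lipschitz in `L¹`, this is `O(|r
- t|²)`. -/
theorem hasDerivAt_functional (hF : EnergyAssumption F dF d2F)
    (hf : IsReplicatorFlow dF μ s m f) (t : ℝ) :
    HasDerivAt (fun r => F (m r))
      (-∫ x, replicatorRate dF μ s (m t) (f t) x * f t x * dF (m t) x ∂μ) t := by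
  obtain ⟨C, -, hC⟩ := hF.bound_first
  obtain ⟨K, hK⟩ := hF.exists_norm_boundedDeriv_sub_le
  obtain ⟨A, hA⟩ := hf.isLocallyBounded_rate_mul hF (|t| + 1)
  have hfm : ∀ t, Measurable (f t) := fun t => (hf.density t).measurable
  have hψ := hF.first.measurable (m t)
  have hlin : HasDerivAt (fun r => ∫ x, f r x * dF (m t) x ∂μ)
      (∫ x, -(replicatorRate dF μ s (m t) (f t) x) * f t x * dF (m t) x ∂μ) t := by
    refine IsLocallyBounded.hasDerivAt_integral
      (ψ := fun r x => -(replicatorRate dF μ s (m r) (f r) x) * f r x * dF (m t) x)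
      ?_ (fun r => (hfm r).mul hψ) (fun r => (hf.density r).integrable_mul hψ (hC _))
      (fun r => ((hf.measurable_replicatorRate hF r).neg.mul (hfm r)).mul hψ)
      (fun x r => (hf.equation x r).mul_const _) t
    convert ((hf.isLocallyBounded_rate_mul hF).mul
      (IsLocallyBounded.of_forall_abs_le (φ := fun _ => dF (m t)) fun _ => hC (m t))).neg using 3
    ring
  have hlip : ∀ r, |r| ≤ |t| + 1 →
      ∫ x, |f r x - f t x| ∂μ ≤ A * μ.real Set.univ * |r - t| := by
    intro r hr
    have hpt : ∀ x, |f r x - f t x| ≤ A * |r - t| := fun x => by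
      refine (convex_Icc (-(|t| + 1)) (|t| + 1)).norm_image_sub_le_of_norm_hasDerivWithin_le
        (f := fun r => f r x) (fun q _ => (hf.equation x q).hasDerivWithinAt) (fun q hq => ?_)
        (abs_le.1 (by linarith)) (abs_le.1 hr)
      rw [neg_mul, norm_neg]
      exact hA q (abs_le.2 hq) x
    calc ∫ x, |f r x - f t x| ∂μ ≤ ∫ _, A * |r - t| ∂μ :=
          integral_mono ((hf.density r).integrable.sub (hf.density t).integrable).abs
            (integrable_const _) hpt
      _ = A * μ.real Set.univ * |r - t| := by
          rw [integral_const, smul_eq_mul]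
          ring
  have hrem : HasDerivAt
      (fun r => F (m r) - F (m t) - ∫ x, dF (m t) x * (f r x - f t x) ∂μ) 0 t := by
    have hO : (fun r => F (m r) - F (m t) - ∫ x, dF (m t) x * (f r x - f t x) ∂μ)
        =O[𝓝 t] fun r => ‖r - t‖ ^ 2 := by
      refine Asymptotics.IsBigO.of_bound (K * (A * μ.real Set.univ) ^ 2) ?_
      filter_upwards [continuous_abs.continuousAt.eventually (gt_mem_nhds (lt_add_one |t|))]
        with r hr
      have h0 : 0 ≤ ∫ x, |f r x - f t x| ∂μ := integral_nonneg fun _ => abs_nonneg _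
      have h1 := hF.first.abs_sub_sub_integral_le (hf.density t) (hf.density r) hψ
        (C := K * ∫ x, |f r x - f t x| ∂μ) fun l x => by
          refine (boundedMeasurable.abs_sub_apply_le (hF.boundedDeriv _) (hF.boundedDeriv _)
            x).trans ((hK μ _ _ _ _ (hf.density t) ((hf.density t).mixture (hf.density r) l)).trans ?_)
          exact mul_le_mul_of_nonneg_left
            ((hf.density t).integral_abs_mixture_sub (hf.density r) l) K.2
      refine h1.trans ?_
      rw [norm_pow, norm_norm, Real.norm_eq_abs]
      calc K * (∫ x, |f r x - f t x| ∂μ) * ∫ x, |f r x - f t x| ∂μ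
          = K * (∫ x, |f r x - f t x| ∂μ) ^ 2 := by ring
        _ ≤ K * (A * μ.real Set.univ * |r - t|) ^ 2 := by
          gcongr
          exact hlip r hr.le
        _ = K * (A * μ.real Set.univ) ^ 2 * |r - t| ^ 2 := by ring
    exact (hO.hasFDerivAt (by norm_num)).hasDerivAt
  have hsum := (hrem.add hlin).add_const (F (m t))
  refine (hsum.congr_deriv ?_).congr_of_eventuallyEq (.of_forall fun r => ?_)
  · rw [zero_add, ← integral_neg]
    simp only [neg_mul]
  · have : ∀ x, dF (m t) x * (f r x - f t x) = f r x * dF (m t) x - f t x * dF (m t) x :=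
      fun x => by ring
    simp only [this, Pi.add_apply]
    rw [integral_sub ((hf.density r).integrable_mul hψ (hC _))
      ((hf.density t).integrable_mul hψ (hC _)), hF.integral_density_mul_eq_zero (hf.density t)]
    ring

theorem integrable_sq_rate_mul (hF : EnergyAssumption F dF d2F)
    (hf : IsReplicatorFlow dF μ s m f) (t : ℝ) :
    Integrable (fun x => replicatorRate dF μ s (m t) (f t) x ^ 2 * f t x) μ := by
  simp only [replicatorRate_sq_mul]
  exact ((hf.integrable_rate_mul_first hF t).add
    ((hf.integrable_rate_mul_mul_log hF t).const_mul s)).sub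
    ((hf.integrable_rate_mul hF t).const_mul _)

/-- **Energy dissipation** along a solution of the birth-death equation. -/
theorem hasDerivAt_energy (hF : EnergyAssumption F dF d2F)
    (hf : IsReplicatorFlow dF μ s m f) (t : ℝ) :
    HasDerivAt (fun r => F (m r) + s * ∫ x, f r x * Real.log (f r x) ∂μ)
      (-∫ x, replicatorRate dF μ s (m t) (f t) x ^ 2 * f t x ∂μ) t := by
  refine ((hf.hasDerivAt_functional hF t).add
    ((hf.hasDerivAt_entropy hF t).const_mul s)).congr_deriv ?_
  simp only [replicatorRate_sq_mul]
  have h1 := hf.integrable_rate_mul_first hF t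
  have h2 := (hf.integrable_rate_mul_mul_log hF t).const_mul s
  have h3 : Integrable (fun x => replicatorRate dF μ s (m t) (f t) x * f t x * dF (m t) x +
      s * (replicatorRate dF μ s (m t) (f t) x * f t x * Real.log (f t x))) μ := h1.add h2
  rw [integral_sub h3 ((hf.integrable_rate_mul hF t).const_mul _), integral_add h1 h2,
    integral_const_mul, integral_const_mul, hf.integral_rate_mul hF]
  ring

end IsReplicatorFlow

end Dissipation

/-! ### The scalar equation `f' = -(q + s log f) f` -/

section Scalar

variable {s : ℝ} {f q Q : ℝ → ℝ}

/-- The set of times at which the formula holds is clopen in `[0, ∞)`: closed by continuity, and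
open because `f > 0` persists near such a time and there `exp (s u) log f + Q` has zero derivative.
The starting time `t₀` is arbitrary so that the formula also propagates backwards. -/
theorem eq_exp_of_hasDerivWithinAt_log
    (hf : ∀ t, 0 ≤ t → HasDerivWithinAt f (-(q t + s * Real.log (f t)) * f t) (Set.Ici 0) t)
    (hQ : ∀ t, 0 ≤ t → HasDerivWithinAt Q (Real.exp (s * t) * q t) (Set.Ici 0) t) {c t₀ : ℝ}
    (ht₀ : 0 ≤ t₀) (h0 : f t₀ = Real.exp ((c - Q t₀) * Real.exp (-(s * t₀)))) {t : ℝ}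
    (ht : 0 ≤ t) : f t = Real.exp ((c - Q t) * Real.exp (-(s * t))) := by
  have hfc : ContinuousOn f (Set.Ici 0) := fun t ht => (hf t ht).continuousWithinAt
  have hQc : ContinuousOn Q (Set.Ici 0) := fun t ht => (hQ t ht).continuousWithinAt
  have hec : ContinuousOn (fun t => Real.exp ((c - Q t) * Real.exp (-(s * t)))) (Set.Ici 0) := by
    fun_prop
  set A : Set (Set.Ici (0 : ℝ)) :=
    {t | f t = Real.exp ((c - Q t) * Real.exp (-(s * t)))} with hA
  have hclosed : IsClosed A :=
    isClosed_eq hfc.domRestrict hec.domRestrict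
  have hopen : IsOpen A := by
    rw [Metric.isOpen_iff]
    rintro ⟨r, hr⟩ hrA
    have hrA' : f r = Real.exp ((c - Q r) * Real.exp (-(s * r))) := hrA
    have hpos : 0 < f r := hrA' ▸ Real.exp_pos _
    obtain ⟨ε, hε, hball⟩ := Metric.mem_nhdsWithin_iff.1 ((hfc r hr) (lt_mem_nhds hpos))
    refine ⟨ε, hε, ?_⟩
    rintro ⟨r', hr'⟩ hrr'
    have hrr : r' ∈ Metric.ball r ε := hrr'
    have hder : ∀ q' ∈ Metric.ball r ε ∩ Set.Ici 0,
        HasDerivWithinAt (fun u => Real.exp (s * u) * Real.log (f u) + Q u) 0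
          (Metric.ball r ε ∩ Set.Ici 0) q' := by
      intro u hu
      have hu0 : 0 < f u := hball hu
      have h1 : HasDerivWithinAt (fun u => Real.exp (s * u)) (Real.exp (s * u) * (s * 1))
          (Set.Ici 0) u := ((hasDerivAt_id u).const_mul s).exp.hasDerivWithinAt
      have h2 := (h1.mul ((hf u hu.2).log hu0.ne')).add (hQ u hu.2)
      refine (h2.congr_deriv ?_).mono Set.inter_subset_right
      field_simp [hu0.ne']
      ring
    have hconst := ((convex_ball r ε).inter (convex_Ici 0)).norm_image_sub_le_of_norm_hasDerivWithin_le
      (C := 0) hder (fun _ _ => by simp) ⟨Metric.mem_ball_self hε, hr⟩ ⟨hrr, hr'⟩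
    rw [zero_mul, norm_le_zero_iff, sub_eq_zero] at hconst
    have hee : ∀ u : ℝ, Real.exp (s * u) * Real.exp (-(s * u)) = 1 := fun u => by
      rw [← Real.exp_add, add_neg_cancel, Real.exp_zero]
    have hpos' : 0 < f r' := hball ⟨hrr, hr'⟩
    change f r' = Real.exp ((c - Q r') * Real.exp (-(s * r')))
    rw [← Real.exp_log hpos']
    congr 1
    have hlog : Real.log (f r) = (c - Q r) * Real.exp (-(s * r)) := by rw [hrA', Real.log_exp]
    have h3 : Real.exp (s * r) * Real.log (f r) + Q r = c := by
      rw [hlog]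
      linear_combination (c - Q r) * hee r
    have h4 : Real.exp (s * r') * Real.log (f r') = c - Q r' := by linarith
    rw [← h4]
    linear_combination (-Real.log (f r')) * hee r'
  have huniv : A = Set.univ := by
    have : PreconnectedSpace (Set.Ici (0 : ℝ)) :=
      Subtype.preconnectedSpace isPreconnected_Ici
    exact IsClopen.eq_univ ⟨hclosed, hopen⟩ ⟨⟨t₀, ht₀⟩, h0⟩
  exact (huniv ▸ Set.mem_univ (⟨t, ht⟩ : Set.Ici (0 : ℝ)) : (⟨t, ht⟩ : Set.Ici (0 : ℝ)) ∈ A)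

/-- The explicit solution of the scalar equation, including the solution that vanishes. -/
theorem eq_rpow_of_hasDerivWithinAt_log (h0 : ∀ t, 0 ≤ t → 0 ≤ f t)
    (hf : ∀ t, 0 ≤ t → HasDerivWithinAt f (-(q t + s * Real.log (f t)) * f t) (Set.Ici 0) t)
    (hQ : ∀ t, 0 ≤ t → HasDerivWithinAt Q (Real.exp (s * t) * q t) (Set.Ici 0) t) {t : ℝ}
    (ht : 0 ≤ t) : f t = (f 0 * Real.exp (Q 0 - Q t)) ^ Real.exp (-(s * t)) := by
  rcases (h0 0 le_rfl).eq_or_lt with hz | hz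
  · rw [← hz, zero_mul, Real.zero_rpow (Real.exp_pos _).ne']
    by_contra hne
    have hpos : 0 < f t := (h0 t ht).lt_of_ne' hne
    -- If `f` were positive at `t`, propagating the formula back from `t` would make `f 0` an
    -- exponential, hence positive.
    have := eq_exp_of_hasDerivWithinAt_log hf hQ (c := Real.exp (s * t) * Real.log (f t) + Q t) ht
      (by
        rw [add_sub_cancel_right, mul_right_comm, ← Real.exp_add, add_neg_cancel, Real.exp_zero,
          one_mul, Real.exp_log hpos]) le_rfl
    exact absurd hz (this ▸ (Real.exp_pos _).ne)
  · rw [eq_exp_of_hasDerivWithinAt_log hf hQ (c := Real.log (f 0) + Q 0) le_rfl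
      (by simp [Real.exp_log hz]) ht, Real.rpow_def_of_pos (mul_pos hz (Real.exp_pos _)),
      Real.log_mul hz.ne' (Real.exp_pos _).ne', Real.log_exp, add_sub_assoc]

/-- No primitive of `exp (s t) q` is available here. If `f ≤ N` on `[0, t]`, then `log f ≤ f ≤ N`,
so the death rate is at most `D = C + s N` and `f exp (D r)` is nondecreasing. -/
theorem pos_of_hasDerivWithinAt_log (hs : 0 ≤ s) (h0 : ∀ t, 0 ≤ t → 0 ≤ f t) {C : ℝ}
    (hq : ∀ t, 0 ≤ t → q t ≤ C)
    (hf : ∀ t, 0 ≤ t → HasDerivWithinAt f (-(q t + s * Real.log (f t)) * f t) (Set.Ici 0) t)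
    (hpos : 0 < f 0) {t : ℝ} (ht : 0 ≤ t) : 0 < f t := by
  have hfc : ContinuousOn f (Set.Icc 0 t) := fun r hr =>
    (hf r hr.1).continuousWithinAt.mono Set.Icc_subset_Ici_self
  obtain ⟨N, hN⟩ := isCompact_Icc.exists_bound_of_continuousOn hfc
  set D := C + s * N
  have hexp : ∀ r, HasDerivAt (fun r => Real.exp (D * r)) (Real.exp (D * r) * (D * 1)) r :=
    fun r => ((hasDerivAt_id r).const_mul D).exp
  have hder : ∀ r ∈ interior (Set.Icc 0 t), HasDerivAt (fun r => f r * Real.exp (D * r))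
      (-(q r + s * Real.log (f r)) * f r * Real.exp (D * r) +
        f r * (Real.exp (D * r) * (D * 1))) r := fun r hr => by
    rw [interior_Icc] at hr
    exact ((hf r hr.1.le).hasDerivAt (Ici_mem_nhds hr.1)).mul (hexp r)
  have hmono : MonotoneOn (fun r => f r * Real.exp (D * r)) (Set.Icc 0 t) := by
    refine monotoneOn_of_deriv_nonneg (convex_Icc 0 t)
      (hfc.mul fun r _ => (hexp r).continuousAt.continuousWithinAt)
      (fun r hr => (hder r hr).differentiableAt.differentiableWithinAt) fun r hr => ?_
    rw [(hder r hr).deriv]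
    rw [interior_Icc] at hr
    have hfr := h0 r hr.1.le
    have h1 : Real.log (f r) ≤ N := (Real.log_le_self hfr).trans
      ((le_abs_self _).trans (hN r (Set.Ioo_subset_Icc_self hr)))
    have h2 : 0 ≤ D - (q r + s * Real.log (f r)) := by
      have := mul_le_mul_of_nonneg_left h1 hs
      have := hq r hr.1.le
      simp only [D]
      linarith
    have : -(q r + s * Real.log (f r)) * f r * Real.exp (D * r) +
        f r * (Real.exp (D * r) * (D * 1)) =
        (D - (q r + s * Real.log (f r))) * (f r * Real.exp (D * r)) := by ring
    rw [this]
    exact mul_nonneg h2 (mul_nonneg hfr (Real.exp_pos _).le)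
  have := hmono ⟨le_rfl, ht⟩ ⟨ht, le_rfl⟩ ht
  simp only [mul_zero, Real.exp_zero, mul_one] at this
  exact pos_of_mul_pos_left (hpos.trans_le this) (Real.exp_pos _).le

end Scalar

/-! ### Uniqueness -/

section Uniqueness

variable {d : ℕ} {F : ProbabilityMeasure (EuclideanSpace ℝ (Fin d)) → ℝ}
  {dF : ProbabilityMeasure (EuclideanSpace ℝ (Fin d)) → EuclideanSpace ℝ (Fin d) → ℝ}
  {d2F : ProbabilityMeasure (EuclideanSpace ℝ (Fin d)) →
    EuclideanSpace ℝ (Fin d) → EuclideanSpace ℝ (Fin d) → ℝ}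
  {μ : Measure (EuclideanSpace ℝ (Fin d))} {s : ℝ}
  {m : ℝ → ProbabilityMeasure (EuclideanSpace ℝ (Fin d))}
  {f : ℝ → EuclideanSpace ℝ (Fin d) → ℝ}

/-- The flat derivative is continuous along curves with almost everywhere continuous densities. -/
theorem EnergyAssumption.continuous_boundedDeriv_of_continuousOn (hF : EnergyAssumption F dF d2F)
    (hd : ∀ t, 0 ≤ t → IsDensity μ (m t) (f t))
    (hc : ∀ᵐ x ∂μ, ContinuousOn (fun t => f t x) (Set.Ici 0)) :
    Continuous fun t => hF.boundedDeriv (m (max t 0)) := by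
  obtain ⟨K, hK⟩ := hF.exists_norm_boundedDeriv_sub_le
  -- The curve is frozen at its initial value for negative times, so that it is continuous on the
  -- whole line and can be integrated from `0`.
  have hd' : ∀ t, IsDensity μ (m (max t 0)) (f (max t 0)) := fun t => hd _ (le_max_right _ _)
  refine continuous_iff_continuousAt.2 fun t => ?_
  rw [ContinuousAt, tendsto_iff_norm_sub_tendsto_zero]
  refine squeeze_zero (fun _ => norm_nonneg _) (fun t' => hK μ _ _ _ _ (hd' t) (hd' t')) ?_
  have h1 := tendsto_integral_abs_sub_of_tendsto_ae (μ := μ) (l := 𝓝 t)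
    (F := fun t' => f (max t' 0)) (f := f (max t 0)) (.of_forall fun t' => (hd' t').integrable)
    (hd' t).integrable (.of_forall fun t' => .of_forall (hd' t').nonneg)
    (.of_forall (hd' t).nonneg)
    (.of_forall fun t' => by rw [(hd' t').integral_eq_one, (hd' t).integral_eq_one])
    (hc.mono fun x hx => by
      have hcomp : Continuous fun t' : ℝ => f (max t' 0) x :=
        hx.comp_continuous (by fun_prop) fun t' => Set.mem_Ici.2 (le_max_right _ _)
      exact hcomp.tendsto t)
  simpa using h1.const_mul (K : ℝ)

variable [IsFiniteMeasure μ] {g : EuclideanSpace ℝ (Fin d) → ℝ} {B : ℝ}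

/-- Every solution with initial density `g` is a normalised power of `g` times an exponential. -/
theorem EnergyAssumption.exists_eq_powDensity (hF : EnergyAssumption F dF d2F) (hs : 0 ≤ s)
    (hg : IsBoundedWeight μ g B) {κ : ℝ → ℝ} (hκ : ∀ t, 0 ≤ t → 0 ≤ κ t)
    (hd : ∀ t, 0 ≤ t → IsDensity μ (m t) (f t)) (hfg : f 0 =ᵐ[μ] g)
    (heq : ∀ᵐ x ∂μ, ∀ t, 0 ≤ t → HasDerivWithinAt (fun r => f r x)
      (-(dF (m t) x + s * Real.log (f t x) - s * κ t) * f t x) (Set.Ici 0) t) :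
    ∃ k : ℝ → boundedMeasurable (EuclideanSpace ℝ (Fin d)), k 0 = 0 ∧
      (∀ t, 0 ≤ t → HasDerivAt k (Real.exp (s * t) • hF.boundedDeriv (m t)) t) ∧
      ∀ t, 0 ≤ t →
        f t =ᵐ[μ] powDensity μ (fun x => g x * Real.exp (-k t x)) (Real.exp (-(s * t))) := by
  have hb := hF.continuous_boundedDeriv_of_continuousOn hd
    (heq.mono fun x hx t ht => (hx t ht).continuousWithinAt)
  have hexp : Continuous fun t : ℝ => Real.exp (s * t) := by fun_prop
  have hcont : Continuous fun t => Real.exp (s * t) • hF.boundedDeriv (m (max t 0)) := hexp.smul hb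
  set k : ℝ → boundedMeasurable (EuclideanSpace ℝ (Fin d)) :=
    fun t => ∫ r in (0 : ℝ)..t, Real.exp (s * r) • hF.boundedDeriv (m (max r 0)) with hk
  have hkd : ∀ t, 0 ≤ t → HasDerivAt k (Real.exp (s * t) • hF.boundedDeriv (m t)) t := by
    intro t ht
    have := (hcont.integral_hasStrictDerivAt 0 t).hasDerivAt
    simpa only [max_eq_left ht] using this
  have hk0 : k 0 = 0 := by simp [hk]
  refine ⟨k, hk0, hkd, ?_⟩
  have hkx : ∀ x t, 0 ≤ t →
      HasDerivWithinAt (fun r => k r x) (Real.exp (s * t) * dF (m t) x) (Set.Ici 0) t :=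
    fun x t ht => (boundedMeasurable.hasDerivAt_apply (hkd t ht) x).hasDerivWithinAt
  obtain ⟨C, -, hC⟩ := hF.bound_first
  have heq' : ∀ᵐ x ∂μ, ∀ t, 0 ≤ t → HasDerivWithinAt (fun r => f r x)
      (-((dF (m t) x - s * κ t) + s * Real.log (f t x)) * f t x) (Set.Ici 0) t :=
    heq.mono fun x hx t ht => (hx t ht).congr_deriv (by ring)
  -- Nothing is known about the regularity of `κ` in time, so a primitive cannot be obtained by
  -- integration. It is read off from the solution at a single point `y` where the initial density
  -- is positive.
  obtain ⟨y, hy, hy0⟩ : ∃ y, (∀ t, 0 ≤ t → HasDerivWithinAt (fun r => f r y)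
      (-((dF (m t) y - s * κ t) + s * Real.log (f t y)) * f t y) (Set.Ici 0) t) ∧ 0 < f 0 y := by
    by_contra! hcon
    refine hg.not_ae_zero ?_
    filter_upwards [heq', hfg] with x hx hxg
    rw [← hxg]
    exact le_antisymm (hcon x hx) ((hd 0 le_rfl).nonneg x)
  have hypos : ∀ t, 0 ≤ t → 0 < f t y := fun t ht =>
    pos_of_hasDerivWithinAt_log (q := fun t => dF (m t) y - s * κ t) hs
      (fun t ht => (hd t ht).nonneg y)
      (fun t ht => (sub_le_self _ (mul_nonneg hs (hκ t ht))).trans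
        ((le_abs_self _).trans (hC (m t) y))) hy hy0 ht
  -- By the equation at `y`, `W` is a primitive of `exp (s t) s κ`, and it does not depend on `x`.
  set W : ℝ → ℝ := fun t => Real.exp (s * t) * Real.log (f t y) + k t y with hW
  have hWd : ∀ t, 0 ≤ t →
      HasDerivWithinAt W (Real.exp (s * t) * (s * κ t)) (Set.Ici 0) t := by
    intro t ht
    have h1 : HasDerivWithinAt (fun u => Real.exp (s * u)) (Real.exp (s * t) * (s * 1))
        (Set.Ici 0) t := ((hasDerivAt_id t).const_mul s).exp.hasDerivWithinAt
    have hne := (hypos t ht).ne'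
    refine ((h1.mul ((hy t ht).log hne)).add (hkx y t ht)).congr_deriv ?_
    field_simp
    ring
  intro t ht
  have hkt := hg.mul_exp_neg (k t)
  set p := Real.exp (-(s * t)) with hp
  have hform : ∀ᵐ x ∂μ, f t x =
      Real.exp ((W t - W 0) * p) * (g x * Real.exp (-k t x)) ^ p := by
    filter_upwards [heq', hfg] with x hx hxg
    have h1 := eq_rpow_of_hasDerivWithinAt_log (q := fun t => dF (m t) x - s * κ t)
      (Q := fun t => k t x - W t) (fun t ht => (hd t ht).nonneg x) hx
      (fun t ht => ((hkx x t ht).sub (hWd t ht)).congr_deriv (by ring)) ht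
    rw [h1, hk0, boundedMeasurable.zero_apply, hxg, Real.exp_mul,
      ← Real.mul_rpow (Real.exp_pos _).le (hkt.nonneg x), mul_left_comm, ← Real.exp_add]
    congr 3
    ring
  -- The unknown factor is constant in space, so unit mass identifies it as the inverse of the
  -- normalising integral.
  have hone : Real.exp ((W t - W 0) * p) * ∫ x, (g x * Real.exp (-k t x)) ^ p ∂μ = 1 := by
    rw [← integral_const_mul, ← integral_congr_ae hform, (hd t ht).integral_eq_one]
  filter_upwards [hform] with x hx
  rw [hx, powDensity, eq_div_iff (hkt.integral_rpow_pos (Real.exp_pos _)).ne', mul_right_comm,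
    hone, one_mul]

end Uniqueness

/-! ### Densities with respect to Lebesgue measure and with respect to the Gibbs measure -/

section Gibbs

variable {d : ℕ} {U : EuclideanSpace ℝ (Fin d) → ℝ}
  {π m : ProbabilityMeasure (EuclideanSpace ℝ (Fin d))}
  {ρ f : EuclideanSpace ℝ (Fin d) → ℝ}

/-- If the normalising integral were `0`, which is also its default value for a non-integrable `exp
(-U)`, division by zero would make the density vanish identically, contradicting that `π` has mass
one. -/
theorem gibbsDensity_pos (hπ : HasDensity π (gibbsDensity U)) (x : EuclideanSpace ℝ (Fin d)) :
    0 < gibbsDensity U x := by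
  have h0 : 0 ≤ ∫ y, Real.exp (-U y) := integral_nonneg fun _ => (Real.exp_pos _).le
  refine div_pos (Real.exp_pos _) (h0.lt_of_ne' fun h => ?_)
  have hz : ∀ x, gibbsDensity U x = 0 := fun x => by rw [gibbsDensity, h, div_zero]
  have h1 : (π : Measure (EuclideanSpace ℝ (Fin d))) Set.univ = 1 := measure_univ
  rw [hπ.eq_withDensity] at h1
  simp [hz] at h1

theorem HasDensity.absolutelyContinuous (h : HasDensity m ρ) :
    (m : Measure (EuclideanSpace ℝ (Fin d))) ≪ volume := by
  rw [h.eq_withDensity]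
  exact withDensity_absolutelyContinuous _ _

theorem HasDensity.isDensity (hπ : HasDensity π (gibbsDensity U)) (h : HasDensity m ρ) :
    IsDensity (π : Measure (EuclideanSpace ℝ (Fin d))) m fun x => ρ x / gibbsDensity U x where
  measurable := h.measurable.div hπ.measurable
  nonneg x := div_nonneg (h.nonneg x) (hπ.nonneg x)
  eq_withDensity := by
    have hq : Measurable fun x => ρ x / gibbsDensity U x := h.measurable.div hπ.measurable
    rw [hπ.eq_withDensity, h.eq_withDensity, ← withDensity_mul _ hπ.measurable.ennreal_ofReal
      hq.ennreal_ofReal]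
    congr 1
    funext x
    rw [Pi.mul_apply, ← ENNReal.ofReal_mul (hπ.nonneg x), mul_div_cancel₀ _ (gibbsDensity_pos hπ x).ne']

theorem IsDensity.hasDensity (hπ : HasDensity π (gibbsDensity U))
    (h : IsDensity (π : Measure (EuclideanSpace ℝ (Fin d))) m f) :
    HasDensity m fun x => f x * gibbsDensity U x where
  measurable := h.measurable.mul hπ.measurable
  nonneg x := mul_nonneg (h.nonneg x) (hπ.nonneg x)
  eq_withDensity := by
    rw [h.eq_withDensity, hπ.eq_withDensity, ← withDensity_mul _ hπ.measurable.ennreal_ofReal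
      h.measurable.ennreal_ofReal]
    congr 1
    funext x
    rw [Pi.mul_apply, ← ENNReal.ofReal_mul (hπ.nonneg x), mul_comm]

theorem IsDensity.birthDeathRate_eq (hπ : HasDensity π (gibbsDensity U))
    (h : IsDensity (π : Measure (EuclideanSpace ℝ (Fin d))) m f)
    (dF : ProbabilityMeasure (EuclideanSpace ℝ (Fin d)) → EuclideanSpace ℝ (Fin d) → ℝ) (σ : ℝ)
    (x : EuclideanSpace ℝ (Fin d)) :
    birthDeathRate dF σ U π m (fun x => f x * gibbsDensity U x) x =
      replicatorRate dF π (σ ^ 2 / 2) m f x := by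
  rw [birthDeathRate, replicatorRate, h.klReal_eq, mul_div_cancel_right₀ _ (gibbsDensity_pos hπ x).ne']

end Gibbs

/-! ### Existence, uniqueness and energy dissipation for the birth-death equation -/

theorem mainTheorem4 {d : ℕ}
    (F : ProbabilityMeasure (EuclideanSpace ℝ (Fin d)) → ℝ)
    (dF : ProbabilityMeasure (EuclideanSpace ℝ (Fin d)) → EuclideanSpace ℝ (Fin d) → ℝ)
    (d2F : ProbabilityMeasure (EuclideanSpace ℝ (Fin d)) →
      EuclideanSpace ℝ (Fin d) → EuclideanSpace ℝ (Fin d) → ℝ)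
    (hF : EnergyAssumption F dF d2F)
    (σ : ℝ) (hσ : 0 ≤ σ)
    (U : EuclideanSpace ℝ (Fin d) → ℝ)
    (π : ProbabilityMeasure (EuclideanSpace ℝ (Fin d))) (hπ : HasDensity π (gibbsDensity U))
    (m₀ : ProbabilityMeasure (EuclideanSpace ℝ (Fin d)))
    (ρ₀ : EuclideanSpace ℝ (Fin d) → ℝ) (hm₀ : HasDensity m₀ ρ₀)
    (R : ℝ) (hR : 1 < R) (hsup : ∀ᵐ x, ρ₀ x / gibbsDensity U x ≤ R) :
    ∃ (m : ℝ → ProbabilityMeasure (EuclideanSpace ℝ (Fin d)))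
      (ρ : ℝ → EuclideanSpace ℝ (Fin d) → ℝ),
      IsBirthDeathSolution dF σ U π m₀ m ρ ∧
      (∀ m' ρ', IsBirthDeathSolution dF σ U π m₀ m' ρ' → ∀ t, 0 ≤ t → m' t = m t) ∧
      ∀ t, 0 ≤ t →
        Integrable (fun x => |birthDeathRate dF σ U π (m t) (ρ t) x| ^ 2 * ρ t x) ∧
        HasDerivWithinAt (fun s => energy F σ π (m s))
          (-∫ x, |birthDeathRate dF σ U π (m t) (ρ t) x| ^ 2 * ρ t x) (Set.Ici 0) t := by
  set s : ℝ := σ ^ 2 / 2 with hs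
  have hs0 : 0 ≤ s := by positivity
  set μ : Measure (EuclideanSpace ℝ (Fin d)) := (π : Measure (EuclideanSpace ℝ (Fin d))) with hμ
  have hG := gibbsDensity_pos hπ
  -- Truncation at `R` changes the initial density on a null set only and makes the bound hold at
  -- every point.
  set g : EuclideanSpace ℝ (Fin d) → ℝ := fun x => min (ρ₀ x / gibbsDensity U x) R with hgdef
  have hf₀ : IsDensity μ m₀ fun x => ρ₀ x / gibbsDensity U x := hπ.isDensity hm₀
  have hg₀ : IsDensity μ m₀ g := by
    refine hf₀.congr_ae (hf₀.measurable.min measurable_const)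
      (fun x => le_min (hf₀.nonneg x) (by linarith)) ?_
    filter_upwards [hπ.absolutelyContinuous.ae_le hsup] with x hx
    exact (min_eq_left hx).symm
  have hg : IsBoundedWeight μ g R := by
    refine ⟨hg₀.measurable, hg₀.nonneg, fun x => min_le_right _ _, fun h => ?_⟩
    have h1 := hg₀.integral_eq_one
    rw [integral_congr_ae h] at h1
    simp at h1
  have hex : ∀ (t : ℝ) (k : boundedMeasurable (EuclideanSpace ℝ (Fin d))),
      ∃ m : ProbabilityMeasure (EuclideanSpace ℝ (Fin d)), IsDensity μ m
        (powDensity μ (fun x => g x * Real.exp (-k x)) (Real.exp (-(s * t)))) :=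
    fun t k => (hg.mul_exp_neg k).exists_isDensity (Real.exp_pos _)
  choose M hM using hex
  obtain ⟨K, hK⟩ := hF.exists_lipschitzWith hg hM
  obtain ⟨k, hk0, hk⟩ := hF.exists_flow hg hR.le hM
  have hflow := hF.isReplicatorFlow (m := fun t => M t (k t)) hg hR.le hk fun t => hM t (k t)
  set f : ℝ → EuclideanSpace ℝ (Fin d) → ℝ := fun t =>
    powDensity μ (fun x => g x * Real.exp (-k t x)) (Real.exp (-(s * t))) with hf
  have hrate : ∀ t x, birthDeathRate dF σ U π (M t (k t)) (fun x => f t x * gibbsDensity U x) x =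
      replicatorRate dF μ s (M t (k t)) (f t) x :=
    fun t x => (hflow.density t).birthDeathRate_eq hπ dF σ x
  have hsq : ∀ t, (fun x => |birthDeathRate dF σ U π (M t (k t))
      (fun x => f t x * gibbsDensity U x) x| ^ 2 * (f t x * gibbsDensity U x)) =
      fun x => gibbsDensity U x * (replicatorRate dF μ s (M t (k t)) (f t) x ^ 2 * f t x) := by
    intro t
    funext x
    rw [hrate, sq_abs]
    ring
  refine ⟨fun t => M t (k t), fun t x => f t x * gibbsDensity U x, ⟨?_, ?_, ?_, ?_⟩, ?_, ?_⟩
  -- At time `0` the exponent is `1` and `k = 0`, so the normalised power is `g` itself.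
  · refine (hM 0 (k 0)).eq_of_ae_eq hg₀ (.of_forall fun x => ?_)
    simp [powDensity, hk0, hg₀.integral_eq_one]
  · exact fun t _ => (hflow.density t).hasDensity hπ
  · exact fun t _ => (hflow.density t).klDiv_ne_top (hflow.integrable_mul_log t)
  · refine .of_forall fun x t _ => ?_
    refine (((hflow.equation x t).mul_const (gibbsDensity U x)).hasDerivWithinAt).congr_deriv ?_
    rw [hrate, mul_assoc]
  · intro m' ρ' h' t ht
    have hd : ∀ t, 0 ≤ t → IsDensity μ (m' t) fun x => ρ' t x / gibbsDensity U x :=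
      fun t ht => hπ.isDensity (h'.density t ht)
    have h0 : (fun x => ρ' 0 x / gibbsDensity U x) =ᵐ[μ] g := by
      have h1 := (hd 0 le_rfl).eq_withDensity
      rw [h'.initial, hg₀.eq_withDensity, withDensity_eq_iff
        hg₀.measurable.ennreal_ofReal.aemeasurable
        (hd 0 le_rfl).measurable.ennreal_ofReal.aemeasurable] at h1
      · filter_upwards [h1] with x hx
        exact ((ENNReal.ofReal_eq_ofReal_iff (hg₀.nonneg x) ((hd 0 le_rfl).nonneg x)).1 hx).symm
      · rw [← ofReal_integral_eq_lintegral_ofReal hg₀.integrable (.of_forall hg₀.nonneg)]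
        exact ENNReal.ofReal_ne_top
    have heq : ∀ᵐ x ∂μ, ∀ t, 0 ≤ t → HasDerivWithinAt (fun r => ρ' r x / gibbsDensity U x)
        (-(dF (m' t) x + s * Real.log (ρ' t x / gibbsDensity U x) - s * klReal (m' t) π) *
          (ρ' t x / gibbsDensity U x)) (Set.Ici 0) t := by
      filter_upwards [hπ.absolutelyContinuous.ae_le h'.equation] with x hx t ht
      refine ((hx t ht).div_const _).congr_deriv ?_
      rw [birthDeathRate, mul_div_assoc]
    obtain ⟨k', hk0', hk', hfk'⟩ := hF.exists_eq_powDensity hs0 hg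
      (κ := fun t => klReal (m' t) π) (fun _ _ => ENNReal.toReal_nonneg) hd h0 heq
    have hm' : ∀ t, 0 ≤ t → m' t = M t (k' t) := fun t ht =>
      (hd t ht).eq_of_ae_eq (hM t (k' t)) (hfk' t ht)
    -- Since `m' t = M t (k' t)`, `k'` solves the same closed Lipschitz equation as `k`, with the
    -- same initial value.
    have hkk : k' t = k t :=
      eq_of_forall_hasDerivAt_of_lipschitzWith hK (fun t ht => by rw [← hm' t ht]; exact hk' t ht)
        (fun t _ => hk t) (hk0'.trans hk0.symm) ht
    rw [hm' t ht, hkk]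
  · intro t _
    have hint := hflow.integrable_sq_rate_mul hF t
    have hder := hflow.hasDerivAt_energy hF t
    rw [hsq]
    refine ⟨(integrable_withDensity_ofReal_iff hπ.measurable hπ.nonneg).1
      (by rwa [← hπ.eq_withDensity]), ?_⟩
    rw [← integral_withDensity_ofReal hπ.measurable hπ.nonneg, ← hπ.eq_withDensity]
    refine (hder.congr_of_eventuallyEq (.of_forall fun r => ?_)).hasDerivWithinAt
    rw [energy, (hflow.density r).klReal_eq]
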